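/- Let $\alpha\in(0,1)$ and let $\xi^{(n)}_k$, $n,k\in\mathbb N=\{1,2,\dots\}$, be i.i.d. $\mathbb N$-valued random variables with the Sibuya distribution of parameter $\alpha$, i.e. $\mathbb E\,t^{\xi^{(n)}_k}=1-(1-t)^\alpha$ for $0\le t\le 1$. Put $R^{(n)}(k)=\xi^{(n)}_1+\dots+\xi^{(n)}_k$. In round $n$ of the leader-election procedure, the players with current labels $R^{(n)}(1),R^{(n)}(2),\dots$ stay in the game and are relabelled $1,2,\dots$ in the same order, while all others leave; initially the players are $1,2,3,\dots$. Thus $N^{(0)}_M=M$ and $N^{(n)}_M=\#\{j\in\mathbb N: R^{(n)}(j)\le N^{(n-1)}_M\}$ is the number of players among $1,\dots,M$ who survive the first $n$ rounds, and $S^{(n)}_j=\inf\{i\in\mathbb N: N^{(n)}_i=j\}$ is the original number of the $j$-th survivor of the first $n$ rounds. Let $P_1<P_2<\dots$ be the points of a standard (rate $1$) Poisson process on $(0,\infty)$, and let $G_1,G_2,\dots$ be random variables which, given $(P_i)_{i\ge1}$, are conditionally independent, $G_i$ being geometric with parameter $e^{-P_i}$, i.e. $\mathbb P\{G_i=k\mid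 (P_l)_{l\ge1}\}=(1-e^{-P_i})^{k-1}e^{-P_i}$ for $k\in\mathbb N$. Then, as $n\to\infty$, $$\sum_{j=1}^\infty \delta_{\alpha^n\log S^{(n)}_j}\ \longrightarrow\ \sum_{i=1}^\infty G_i\,\delta_{P_i}$$ weakly as point processes on $[0,\infty)$: both sides are almost surely locally finite measures on $[0,\infty)$, and the convergence is convergence in distribution of random elements of the space of locally finite measures on $[0,\infty)$ endowed with the vague topology. -/

import Mathlib

open MeasureTheory ProbabilityTheory Filter
open scoped NNReal ENNReal

noncomputable section

/-! ### Locally finite measures with the vague topology -/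

/-- The space of locally finite measures on `X`. -/
def LocFinMeasure (X : Type*) [TopologicalSpace X] [MeasurableSpace X] : Type _ :=
  {μ : Measure X // IsLocallyFiniteMeasure μ}

namespace LocFinMeasure

variable {X : Type*} [TopologicalSpace X] [MeasurableSpace X]

/-- The vague topology: the coarsest one for which `μ ↦ ∫ f dμ` is continuous for every
continuous, compactly supported `f : X → ℝ`. -/
instance : TopologicalSpace (LocFinMeasure X) :=
  TopologicalSpace.induced
    (fun (μ : LocFinMeasure X) (f : CompactlySupportedContinuousMap X ℝ) => ∫ x, f x ∂μ.1)
    inferInstance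

/-- The Borel sigma-algebra of the vague topology. -/
instance : MeasurableSpace (LocFinMeasure X) := borel _

instance : BorelSpace (LocFinMeasure X) := ⟨rfl⟩

open Classical in
/-- A locally finite measure, viewed as a point of `LocFinMeasure X`; every other measure is sent
to the zero measure. -/
def ofMeasure (μ : Measure X) : LocFinMeasure X :=
  if h : IsLocallyFiniteMeasure μ then ⟨μ, h⟩ else ⟨0, inferInstance⟩

end LocFinMeasure

/-- The measure `∑ i, w i • δ_{x i}` on `[0, ∞)`, for points `x i ≥ 0` with multiplicities `w i`. -/
def weightedPoints (w : ℕ → ℕ) (x : ℕ → ℝ) : Measure ℝ≥0 :=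
  Measure.sum fun i => (w i : ℝ≥0∞) • Measure.dirac (x i).toNNReal

/-! ### The leader-election procedure

`x n k` is the value of the `(k+1)`-st increment of the random walk that is used in
round `n + 1`. -/

namespace LeaderElection

/-- The walk `R^{(n+1)}(k)`: the sum of the first `k` increments of round `n + 1`. -/
def walk (x : ℕ → ℕ → ℕ) (n k : ℕ) : ℕ := ∑ i ∈ Finset.range k, x n i

/-- The number `N^{(n)}_M` of players among `1, …, M` who survive the first `n` rounds. -/
def survivors (x : ℕ → ℕ → ℕ) : ℕ → ℕ → ℕ
  | 0, M => M
  | n + 1, M => Set.ncard {j : ℕ | 1 ≤ j ∧ walk x n j ≤ survivors x n M}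

/-- The original number `S^{(n)}_j` of the `j`-th player (`j ≥ 1`) among those who survive the
first `n` rounds. -/
def originalNumber (x : ℕ → ℕ → ℕ) (n j : ℕ) : ℕ :=
  sInf {i : ℕ | 1 ≤ i ∧ survivors x n i = j}

/-- The measure `∑_{j ≥ 1} δ_{α ^ n * log S^{(n)}_j}` on `[0, ∞)`. -/
def logPoints (α : ℝ) (x : ℕ → ℕ → ℕ) (n : ℕ) : Measure ℝ≥0 :=
  weightedPoints (fun _ => 1) fun j => α ^ n * Real.log (originalNumber x n (j + 1))

end LeaderElection

variable {Ω : Type*} [MeasurableSpace Ω]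

/-- `X` has the Sibuya distribution with parameter `α`, that is, generating function
`t ↦ 1 - (1 - t) ^ α` on `[0, 1]`. -/
def IsSibuya (α : ℝ) (X : Ω → ℕ) (μ : Measure Ω) : Prop :=
  Measurable X ∧ ∀ t ∈ Set.Icc (0 : ℝ) 1, ∫ ω, t ^ X ω ∂μ = 1 - (1 - t) ^ α

/-- The spacings `P_1, P_2 - P_1, P_3 - P_2, …` of the points (the index `0` stands for `P_1`). -/
def spacing (P : ℕ → Ω → ℝ) : ℕ → Ω → ℝ
  | 0 => P 0
  | i + 1 => fun ω => P (i + 1) ω - P i ω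

/-- `P 0 < P 1 < …` are the points (arrival times), in increasing order, of a standard Poisson
process on `(0, ∞)`: the interarrival times are independent and exponential with mean `1`. -/
structure IsStandardPoissonPoints (P : ℕ → Ω → ℝ) (μ : Measure Ω) : Prop where
  measurable : ∀ i, Measurable (P i)
  indep : iIndepFun (spacing P) μ
  law : ∀ i, μ.map (spacing P i) = expMeasure 1

/-- Given the sequence `P`, the `G i` are conditionally independent, and `G i` is geometric on
`{1, 2, …}` with success parameter `exp (-P i)`: for all `m` and `k 0, …, k (m - 1) ≥ 0`, the
conditional probability of `G i = k i + 1` for all `i < m` given the sigma-algebra of `P` is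
`∏_{i < m} (1 - exp (-P i)) ^ k i * exp (-P i)`. -/
structure IsCondGeometric (G : ℕ → Ω → ℕ) (P : ℕ → Ω → ℝ) (μ : Measure Ω) : Prop where
  measurable : ∀ i, Measurable (G i)
  condProb : ∀ (m : ℕ) (k : ℕ → ℕ),
    μ[Set.indicator {ω | ∀ i < m, G i ω = k i + 1} (fun _ => (1 : ℝ)) |
        MeasurableSpace.comap (fun ω i => P i ω) MeasurableSpace.pi]
      =ᵐ[μ] fun ω => ∏ i ∈ Finset.range m,
        (1 - Real.exp (-P i ω)) ^ k i * Real.exp (-P i ω)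

end

/-! The argument is a coupling. Since $j\le N^{(n)}_M$ exactly when $S^{(n)}_j\le M$, the number
$S^{(n)}_j$ is the sum of the first $j$ gaps between consecutive survivors. One more round merges
these gaps into consecutive blocks with independent Sibuya($\alpha$) lengths. Sibuya generating
functions compose, $1-(1-t)^\beta$ followed by $1-(1-s)^\alpha$ giving $1-(1-t)^{\alpha\beta}$, so
the gaps after $n$ rounds are i.i.d. Sibuya($\alpha^n$) (`exists_map_survivorGap`, resting on
`map_blockSum` and `IsSibuyaLaw.randomSumLaw`).

Realise the gaps for all $n$ at once as quantile transforms of the same i.i.d. standard exponentials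
$E_1,E_2,\dots$. A Sibuya($\beta$) tail at $e^{y/\beta}$ is close to $e^{-y}$ when $\beta$ is small,
so $\alpha^n$ times the logarithm of the $i$-th gap tends to $E_i$ (`tendsto_mul_log_expQuantile`).
On this scale a sum is as large as its maximum (`tendsto_mul_log_sum`). Hence $\alpha^n\log
S^{(n)}_j$ tends to $\max(E_1,\dots,E_j)$ almost surely in the coupling, and the point measures
converge vaguely because these sequences are monotone and unbounded
(`tendsto_ofMeasure_weightedPoints`).

It remains to recognise the running maximum. From level $x$ it stays put with probability $1-e^{-x}$
and otherwise jumps by a fresh exponential, by memorylessness. Its levels are therefore Poisson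
points, and level $P_i$ is held for a geometric time with parameter $e^{-P_i}$. Formally, both
sequences satisfy the same first-step recursion (`maxMean_eq_repeatMean`, `geoMean_repeatProd`), so
their finite-dimensional laws agree (`map_repeatSeq_points`). -/

section
open scoped Topology

/-! ### The vague topology on $[0,\infty)$ and its Borel sets -/

namespace LocFinMeasure

/-- A continuous cutoff function: `1` on `[0, N]` and `0` on `[N + 1, ∞)`. -/
noncomputable def cutoff (N : ℕ) : CompactlySupportedContinuousMap ℝ≥0 ℝ where
  toFun x := max 0 (min 1 (N + 1 - (x : ℝ)))
  continuous_toFun := by fun_prop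
  hasCompactSupport' := by
    refine HasCompactSupport.intro (isCompact_Icc (a := 0) (b := (N + 1 : ℝ≥0))) fun x hx => ?_
    have : (N + 1 : ℝ) < x := by
      by_contra h
      exact hx ⟨zero_le, by exact_mod_cast not_lt.1 h⟩
    exact max_eq_left ((min_le_right _ _).trans (by linarith))

lemma cutoff_apply (N : ℕ) (x : ℝ≥0) : cutoff N x = max 0 (min 1 (N + 1 - (x : ℝ))) := rfl

lemma cutoff_nonneg (N : ℕ) (x : ℝ≥0) : 0 ≤ cutoff N x := le_max_left _ _

lemma cutoff_eq_one {N : ℕ} {x : ℝ≥0} (hx : x ≤ N) : cutoff N x = 1 := by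
  have : (x : ℝ) ≤ N := by exact_mod_cast hx
  rw [cutoff_apply, min_eq_left (by linarith), max_eq_right zero_le_one]

lemma cutoff_eq_zero {N : ℕ} {x : ℝ≥0} (hx : (N + 1 : ℝ) ≤ x) : cutoff N x = 0 :=
  max_eq_left ((min_le_right _ _).trans (by linarith))

/-- A compactly supported continuous function on `[0, ∞)` vanishes outside some `[0, N]`. -/
lemma exists_nat_bound (f : CompactlySupportedContinuousMap ℝ≥0 ℝ) :
    ∃ N : ℕ, ∀ x : ℝ≥0, (N : ℝ≥0) < x → f x = 0 := by
  obtain ⟨b, hb⟩ := f.hasCompactSupport.isCompact.bddAbove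
  obtain ⟨N, hN⟩ := exists_nat_ge b
  refine ⟨N, fun x hx => ?_⟩
  by_contra h
  exact absurd (hb (subset_tsupport _ h)) (not_le.2 (hN.trans_lt hx))

/-- The product of a cutoff function and a continuous function. -/
noncomputable def cutoffMul (N : ℕ) (p : C(ℝ≥0, ℝ)) : CompactlySupportedContinuousMap ℝ≥0 ℝ where
  toFun x := cutoff N x * p x
  continuous_toFun := (cutoff N).continuous.mul p.continuous
  hasCompactSupport' := (cutoff N).hasCompactSupport.mul_right

/-- A countable family of test functions that determines the vague topology on `[0, ∞)`. -/
noncomputable def testFun (q : ℕ × Option ℕ) : CompactlySupportedContinuousMap ℝ≥0 ℝ :=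
  match q.2 with
  | none => cutoff q.1
  | some k => cutoffMul q.1 (TopologicalSpace.denseSeq C(ℝ≥0, ℝ) k)

/-- The error is dominated by $\varepsilon$ times a cutoff chosen before $\varepsilon$. A plain
uniform bound would not control the error of the integral, since the measures need not be finite;
this one is controlled by the integral of a single further test function. -/
lemma exists_testFun_approx (f : CompactlySupportedContinuousMap ℝ≥0 ℝ) :
    ∃ N : ℕ, ∀ ε : ℝ, 0 < ε → ∃ k : ℕ, ∀ x, |f x - testFun (N, some k) x| ≤ ε * cutoff N x := by
  obtain ⟨N, hN⟩ := exists_nat_bound f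
  refine ⟨N, fun ε hε => ?_⟩
  have hK : IsCompact (Set.Icc (0 : ℝ≥0) (N + 1)) := isCompact_Icc
  have hd := TopologicalSpace.denseRange_denseSeq C(ℝ≥0, ℝ)
  have hnhds : {p : C(ℝ≥0, ℝ) | ∀ x ∈ Set.Icc (0 : ℝ≥0) (N + 1),
      dist (f.toContinuousMap x) (p x) < ε} ∈ 𝓝 f.toContinuousMap := by
    have := (ContinuousMap.tendsto_iff_forall_isCompact_tendstoUniformlyOn
      (F := fun p : C(ℝ≥0, ℝ) => p) (p := 𝓝 f.toContinuousMap) (f := f.toContinuousMap)).1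
      tendsto_id _ hK
    exact Metric.tendstoUniformlyOn_iff.1 this ε hε
  obtain ⟨_, hp, k, rfl⟩ := mem_closure_iff_nhds.1 (hd f.toContinuousMap) _ hnhds
  refine ⟨k, fun x => ?_⟩
  have h1 : f x = cutoff N x * f x := by
    rcases le_or_gt x N with hx | hx
    · rw [cutoff_eq_one hx, one_mul]
    · rw [hN x hx, mul_zero]
  change |f x - cutoff N x * TopologicalSpace.denseSeq C(ℝ≥0, ℝ) k x| ≤ _
  rw [h1, ← mul_sub, abs_mul, abs_of_nonneg (cutoff_nonneg N x), mul_comm]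
  rcases le_or_gt x (N + 1) with hx | hx
  · exact mul_le_mul_of_nonneg_right (hp x ⟨zero_le, hx⟩).le (cutoff_nonneg N x)
  · rw [cutoff_eq_zero (by exact_mod_cast hx.le)]; simp

lemma integrable_of_locFin (μ : LocFinMeasure ℝ≥0)
    (f : CompactlySupportedContinuousMap ℝ≥0 ℝ) : Integrable f μ.1 :=
  have := μ.2
  f.continuous.integrable_of_hasCompactSupport f.hasCompactSupport

/-- All integrals of compactly supported continuous functions. -/
noncomputable def vagueEval (μ : LocFinMeasure ℝ≥0)
    (f : CompactlySupportedContinuousMap ℝ≥0 ℝ) : ℝ := ∫ x, f x ∂μ.1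

/-- The integrals of the countably many test functions. -/
noncomputable def testEval (μ : LocFinMeasure ℝ≥0) (q : ℕ × Option ℕ) : ℝ :=
  ∫ x, testFun q x ∂μ.1

lemma topology_eq_induced_vagueEval :
    (instTopologicalSpace : TopologicalSpace (LocFinMeasure ℝ≥0)) =
      TopologicalSpace.induced vagueEval inferInstance := rfl

/-- An $\varepsilon/3$ argument: near `μ₀` the integral of the cutoff stays below `C + 1`, so
replacing `f` by one test function costs at most $\varepsilon/3$ at both measures. -/
lemma continuous_integral_induced (f : CompactlySupportedContinuousMap ℝ≥0 ℝ) :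
    @Continuous _ _ (TopologicalSpace.induced testEval inferInstance) _
      (fun μ : LocFinMeasure ℝ≥0 => vagueEval μ f) := by
  let _ : TopologicalSpace (LocFinMeasure ℝ≥0) :=
    TopologicalSpace.induced testEval inferInstance
  have hd : Continuous testEval := continuous_induced_dom
  have hc : ∀ q, Continuous fun μ : LocFinMeasure ℝ≥0 => testEval μ q := fun q =>
    (continuous_apply q).comp hd
  obtain ⟨N, hN⟩ := exists_testFun_approx f
  rw [continuous_iff_continuousAt]
  intro μ₀
  rw [ContinuousAt, Metric.tendsto_nhds]
  intro ε hε
  have hbound : ∀ (μ : LocFinMeasure ℝ≥0) (δ : ℝ) (k : ℕ),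
      (∀ x, |f x - testFun (N, some k) x| ≤ δ * cutoff N x) →
      |∫ x, f x ∂μ.1 - ∫ x, testFun (N, some k) x ∂μ.1| ≤ δ * ∫ x, cutoff N x ∂μ.1 := by
    intro μ δ k hk
    rw [← integral_sub (integrable_of_locFin μ _) (integrable_of_locFin μ _), ← integral_const_mul]
    exact norm_integral_le_of_norm_le (f := fun x => f x - testFun (N, some k) x)
      ((integrable_of_locFin μ _).const_mul δ) (Eventually.of_forall hk)
  set C := ∫ x, cutoff N x ∂μ₀.1 with hC
  have hC0 : 0 ≤ C := integral_nonneg (cutoff_nonneg N)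
  obtain ⟨k, hk⟩ := hN (ε / (3 * (C + 1))) (by positivity)
  have e1 : ∀ᶠ μ in 𝓝 μ₀, ∫ x, cutoff N x ∂μ.1 < C + 1 :=
    ((hc (N, none)).tendsto μ₀).eventually_lt_const (lt_add_one C)
  have e2 := Metric.tendsto_nhds.1 ((hc (N, some k)).tendsto μ₀) (ε / 3) (by positivity)
  filter_upwards [e1, e2] with μ h1 h2
  have a1 := hbound μ _ k hk
  have a2 := hbound μ₀ _ k hk
  have b1 : ε / (3 * (C + 1)) * (C + 1) = ε / 3 := by field_simp
  have b2 := mul_lt_mul_of_pos_left h1 (show 0 < ε / (3 * (C + 1)) by positivity)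
  have b3 := mul_lt_mul_of_pos_left (lt_add_one C) (show 0 < ε / (3 * (C + 1)) by positivity)
  rw [Real.dist_eq, abs_lt] at h2 ⊢
  simp only [testEval, vagueEval] at h2 ⊢
  rw [abs_le] at a1 a2
  rw [← hC] at a2
  constructor <;> linarith [a1.1, a1.2, a2.1, a2.2, h2.1, h2.2]

/-- The vague topology on `[0, ∞)` is induced by countably many integrals. -/
lemma topology_eq_induced_testFun :
    (instTopologicalSpace : TopologicalSpace (LocFinMeasure ℝ≥0)) =
      TopologicalSpace.induced testEval inferInstance := by
  rw [topology_eq_induced_vagueEval]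
  apply le_antisymm
  · rw [← continuous_iff_le_induced]
    let _ : TopologicalSpace (LocFinMeasure ℝ≥0) :=
      TopologicalSpace.induced vagueEval inferInstance
    have h : Continuous (vagueEval) := continuous_induced_dom
    exact continuous_pi fun q => (continuous_apply (testFun q)).comp h
  · refine continuous_iff_le_induced.1 ?_
    exact (@continuous_pi_iff _ _ _ (TopologicalSpace.induced testEval inferInstance) _ _).2
      continuous_integral_induced

/-- Countability of the test family is what counts: on a countable product of real lines the Borel
and the product sigma-algebras coincide, so the vague Borel sets are generated by the test
integrals. -/
lemma measurable_of_integral {β : Type*} [MeasurableSpace β] {F : β → LocFinMeasure ℝ≥0}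
    (hF : ∀ f : CompactlySupportedContinuousMap ℝ≥0 ℝ, Measurable fun b => ∫ x, f x ∂(F b).1) :
    Measurable F := by
  have h : (instMeasurableSpace : MeasurableSpace (LocFinMeasure ℝ≥0)) =
      MeasurableSpace.comap testEval MeasurableSpace.pi := by
    have h1 : (instMeasurableSpace : MeasurableSpace (LocFinMeasure ℝ≥0)) =
      @borel _ (instTopologicalSpace : TopologicalSpace (LocFinMeasure ℝ≥0)) := rfl
    rw [h1, topology_eq_induced_testFun, borel_comap, ← BorelSpace.measurable_eq]
  rw [h, measurable_comap_iff]
  exact measurable_pi_iff.2 fun q => hF (testFun q)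

lemma isLocallyFiniteMeasure_iff (μ : Measure ℝ≥0) :
    IsLocallyFiniteMeasure μ ↔ ∀ N : ℕ, μ (Set.Iic (N : ℝ≥0)) < ∞ := by
  constructor
  · intro h N
    have : (Set.Iic (N : ℝ≥0)) = Set.Icc 0 (N : ℝ≥0) := by ext; simp
    rw [this]
    exact isCompact_Icc.measure_lt_top
  · refine fun h => ⟨fun x => ?_⟩
    obtain ⟨N, hN⟩ := exists_nat_gt x
    exact ⟨_, Iic_mem_nhds hN, h N⟩

lemma measurableSet_isLocallyFiniteMeasure :
    MeasurableSet {μ : Measure ℝ≥0 | IsLocallyFiniteMeasure μ} := by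
  simp_rw [isLocallyFiniteMeasure_iff, Set.ofPred_forall]
  exact MeasurableSet.iInter fun N =>
    measurableSet_lt (Measure.measurable_coe measurableSet_Iic) measurable_const

lemma coe_ofMeasure {μ : Measure ℝ≥0} (h : IsLocallyFiniteMeasure μ) : (ofMeasure μ).1 = μ :=
  congrArg Subtype.val (dif_pos h)

lemma coe_ofMeasure_of_not {μ : Measure ℝ≥0} (h : ¬ IsLocallyFiniteMeasure μ) :
    (ofMeasure μ).1 = 0 :=
  congrArg Subtype.val (dif_neg h)

lemma measurable_ofMeasure :
    Measurable (ofMeasure : Measure ℝ≥0 → LocFinMeasure ℝ≥0) := by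
  classical
  refine measurable_of_integral fun f => ?_
  have h : (fun μ : Measure ℝ≥0 => ∫ x, f x ∂(ofMeasure μ).1) = fun μ =>
      if IsLocallyFiniteMeasure μ then
        (∫⁻ x, ENNReal.ofReal (f x) ∂μ).toReal - (∫⁻ x, ENNReal.ofReal (-f x) ∂μ).toReal
      else 0 := by
    funext μ
    by_cases hμ : IsLocallyFiniteMeasure μ
    · rw [if_pos hμ, coe_ofMeasure hμ]
      exact integral_eq_lintegral_pos_part_sub_lintegral_neg_part
        (integrable_of_locFin ⟨μ, hμ⟩ f)
    · rw [if_neg hμ, coe_ofMeasure_of_not hμ]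
      exact integral_zero_measure _
  rw [h]
  refine Measurable.ite measurableSet_isLocallyFiniteMeasure ?_ measurable_const
  have hf := f.continuous.measurable
  exact (Measure.measurable_lintegral hf.ennreal_ofReal).ennreal_toReal.sub
    (Measure.measurable_lintegral hf.neg.ennreal_ofReal).ennreal_toReal

end LocFinMeasure

/-! ### Point measures and their vague convergence -/

lemma weightedPoints_apply (w : ℕ → ℕ) (x : ℕ → ℝ) {s : Set ℝ≥0} (hs : MeasurableSet s) :
    weightedPoints w x s = ∑' i, (w i : ℝ≥0∞) * s.indicator 1 (x i).toNNReal := by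
  simp [weightedPoints, Measure.sum_apply _ hs, Measure.dirac_apply' _ hs]

lemma measurable_weightedPoints {β : Type*} [MeasurableSpace β] {w : β → ℕ → ℕ} {x : β → ℕ → ℝ}
    (hw : ∀ i, Measurable fun b => w b i) (hx : ∀ i, Measurable fun b => x b i) :
    Measurable fun b => weightedPoints (w b) (x b) := by
  refine Measure.measurable_of_measurable_coe _ fun s hs => ?_
  simp_rw [weightedPoints_apply _ _ hs]
  refine Measurable.tsum fun i => Measurable.mul ?_ ?_
  · exact measurable_from_top.comp (hw i)
  · exact (measurable_one.indicator hs).comp (hx i).real_toNNReal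

lemma isLocallyFiniteMeasure_weightedPoints {w : ℕ → ℕ} {x : ℕ → ℝ} (hx : Tendsto x atTop atTop) :
    IsLocallyFiniteMeasure (weightedPoints w x) := by
  rw [LocFinMeasure.isLocallyFiniteMeasure_iff]
  intro N
  rw [weightedPoints_apply _ _ measurableSet_Iic]
  obtain ⟨J, hJ⟩ := eventually_atTop.1 (hx.eventually_gt_atTop (N : ℝ))
  rw [tsum_eq_sum (s := Finset.range J)]
  · refine ENNReal.sum_lt_top.2 fun i _ => ENNReal.mul_lt_top (ENNReal.natCast_lt_top _) ?_
    exact (Set.indicator_le_self' (fun _ _ => zero_le) _).trans_lt ENNReal.one_lt_top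
  · intro i hi
    have : (N : ℝ) < x i := hJ i (by simpa using hi)
    rw [Set.indicator_of_notMem, mul_zero]
    rw [Set.mem_Iic, not_le, ← NNReal.coe_lt_coe, Real.coe_toNNReal']
    exact lt_max_of_lt_left (by simpa using this)

/-- If the points beyond index `J` lie outside the support of `f`, then the integral of `f`
is a finite sum. -/
lemma integral_weightedPoints_one {x : ℕ → ℝ} (hx : Tendsto x atTop atTop)
    (f : CompactlySupportedContinuousMap ℝ≥0 ℝ) {J : ℕ}
    (hJ : ∀ j, J ≤ j → f (x j).toNNReal = 0) :
    ∫ y, f y ∂(weightedPoints (fun _ => 1) x) = ∑ j ∈ Finset.range J, f (x j).toNNReal := by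
  have hint := LocFinMeasure.integrable_of_locFin
    ⟨_, isLocallyFiniteMeasure_weightedPoints (w := fun _ => 1) hx⟩ f
  have h : HasSum _ (∫ y, f y ∂(weightedPoints (fun _ => 1) x)) := hasSum_integral_measure hint
  rw [← h.tsum_eq, tsum_eq_sum (s := Finset.range J)]
  · simp
  · intro j hj
    simpa using hJ j (by simpa using hj)

/-- Coordinatewise convergence of increasing sequences that tend to infinity implies the vague
convergence of the corresponding point measures. -/
lemma tendsto_ofMeasure_weightedPoints {x : ℕ → ℕ → ℝ} {y : ℕ → ℝ}
    (hmono : ∀ᶠ n in atTop, Monotone (x n)) (hx : ∀ᶠ n in atTop, Tendsto (x n) atTop atTop)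
    (hy : Tendsto y atTop atTop) (hym : Monotone y)
    (hlim : ∀ j, Tendsto (fun n => x n j) atTop (𝓝 (y j))) :
    Tendsto (fun n => LocFinMeasure.ofMeasure (weightedPoints (fun _ => 1) (x n))) atTop
      (𝓝 (LocFinMeasure.ofMeasure (weightedPoints (fun _ => 1) y))) := by
  rw [LocFinMeasure.topology_eq_induced_vagueEval, nhds_induced, tendsto_comap_iff,
    tendsto_pi_nhds]
  intro f
  obtain ⟨N, hN⟩ := LocFinMeasure.exists_nat_bound f
  -- Once the `J`-th point has passed the support of `f`, monotonicity keeps all later points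
  -- outside. This holds for the limit and, by convergence of that one coordinate, for all large
  -- `n`, so only `J` terms remain.
  obtain ⟨J, hJ⟩ := (hy.eventually_gt_atTop (N : ℝ)).exists
  have hf : ∀ {z : ℕ → ℝ}, Monotone z → (N : ℝ) < z J → ∀ j, J ≤ j → f (z j).toNNReal = 0 := by
    intro z hz hzJ j hj
    refine hN _ ?_
    rw [← NNReal.coe_lt_coe, Real.coe_toNNReal']
    exact lt_max_of_lt_left (by simpa using hzJ.trans_le (hz hj))
  have hval : ∀ {z : ℕ → ℝ}, Monotone z → (N : ℝ) < z J → Tendsto z atTop atTop →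
      ∫ u, f u ∂(LocFinMeasure.ofMeasure (weightedPoints (fun _ => 1) z)).1 =
        ∑ j ∈ Finset.range J, f (z j).toNNReal := by
    intro z hz hzJ hzt
    rw [LocFinMeasure.coe_ofMeasure (isLocallyFiniteMeasure_weightedPoints hzt)]
    exact integral_weightedPoints_one hzt f (hf hz hzJ)
  simp only [Function.comp_def, LocFinMeasure.vagueEval]
  rw [hval hym hJ hy]
  refine Tendsto.congr' (f₁ := fun n => ∑ j ∈ Finset.range J, f (x n j).toNNReal) ?_ ?_
  · filter_upwards [hmono, hx, (hlim J).eventually_const_lt hJ] with n h1 h2 h3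
    exact (hval h1 h3 h2).symm
  · refine tendsto_finsetSum _ fun j _ => ?_
    exact ((f.continuous.comp continuous_real_toNNReal).tendsto _).comp (hlim j)

/-! ### Sibuya laws and their tails -/

/-- The probability generating function determines a distribution on `ℕ`. -/
lemma ext_of_pgf {ρ₁ ρ₂ : Measure ℕ} [IsProbabilityMeasure ρ₁] [IsProbabilityMeasure ρ₂]
    (h : ∀ t ∈ Set.Icc (0 : ℝ) 1, ∫ k, t ^ k ∂ρ₁ = ∫ k, t ^ k ∂ρ₂) : ρ₁ = ρ₂ := by
  set a : ℕ → ℝ := fun k => ρ₁.real {k} - ρ₂.real {k} with ha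
  have hint : ∀ (ρ : Measure ℕ) [IsProbabilityMeasure ρ] (z : ℝ), |z| < 1 →
      HasSum (fun k => z ^ k * ρ.real {k}) (∫ k, z ^ k ∂ρ) := by
    intro ρ _ z hz
    have hi : Integrable (fun k : ℕ => z ^ k) ρ := by
      refine Integrable.of_bound (C := 1) measurable_from_top.aestronglyMeasurable
        (Eventually.of_forall fun k => ?_)
      rw [norm_pow]
      exact pow_le_one₀ (norm_nonneg _) hz.le
    rw [integral_countable hi]
    simp_rw [smul_eq_mul, mul_comm (ρ.real _)]
    refine Summable.hasSum ?_
    refine Summable.of_norm_bounded (summable_geometric_of_lt_one (abs_nonneg z) hz) fun k => ?_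
    rw [norm_mul, norm_pow, Real.norm_eq_abs, Real.norm_eq_abs, abs_of_nonneg measureReal_nonneg]
    exact mul_le_of_le_one_right (by positivity) measureReal_le_one
  have hp : HasFPowerSeriesAt (fun z : ℝ => ∫ k, z ^ k ∂ρ₁ - ∫ k, z ^ k ∂ρ₂)
      (FormalMultilinearSeries.ofScalars ℝ a) 0 := by
    rw [hasFPowerSeriesAt_iff]
    filter_upwards [Metric.ball_mem_nhds (0 : ℝ) one_pos] with z hz
    rw [mem_ball_zero_iff, Real.norm_eq_abs] at hz
    simp only [FormalMultilinearSeries.coeff_ofScalars, zero_add, smul_eq_mul, ha, mul_sub]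
    exact (hint ρ₁ z hz).sub (hint ρ₂ z hz)
  -- The difference of the generating functions is analytic at 0 and vanishes on $(0,1)$, which
  -- accumulates at 0; a nonzero power series has isolated zeros.
  have hzero : FormalMultilinearSeries.ofScalars ℝ a = 0 := by
    by_contra hne
    have h1 := hp.locally_ne_zero hne
    have h2 : ∀ᶠ z : ℝ in 𝓝[>] 0, ∫ k, z ^ k ∂ρ₁ - ∫ k, z ^ k ∂ρ₂ ≠ 0 :=
      h1.filter_mono (nhdsWithin_mono _ fun z hz => ne_of_gt hz)
    obtain ⟨z, hz, hz'⟩ := (h2.and (Ioo_mem_nhdsGT one_pos)).exists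
    exact hz (sub_eq_zero.2 (h z ⟨hz'.1.le, hz'.2.le⟩))
  refine Measure.ext_of_singleton fun k => ?_
  have hk : a k = 0 := by
    rw [← FormalMultilinearSeries.coeff_ofScalars (𝕜 := ℝ) (p := a) (n := k), hzero]
    rfl
  have := sub_eq_zero.1 hk
  exact (measureReal_eq_measureReal_iff).1 this

/-- `ρ` is the Sibuya distribution with parameter `β`. -/
def IsSibuyaLaw (β : ℝ) (ρ : Measure ℕ) : Prop :=
  ∀ t ∈ Set.Icc (0 : ℝ) 1, ∫ k, t ^ k ∂ρ = 1 - (1 - t) ^ β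

namespace IsSibuyaLaw

variable {β : ℝ} {ρ : Measure ℕ} [IsProbabilityMeasure ρ]

lemma integral_one_sub (h : IsSibuyaLaw β ρ) {l : ℝ} (h0 : 0 ≤ l) (h1 : l ≤ 1) :
    Integrable (fun k : ℕ => 1 - (1 - l) ^ k) ρ ∧ ∫ k, (1 - (1 - l) ^ k) ∂ρ = l ^ β := by
  have hi : Integrable (fun k : ℕ => (1 - l) ^ k) ρ := by
    refine Integrable.of_bound (C := 1) measurable_from_top.aestronglyMeasurable
      (Eventually.of_forall fun k => ?_)
    rw [norm_pow, Real.norm_eq_abs, abs_of_nonneg (by linarith)]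
    exact pow_le_one₀ (by linarith) (by linarith)
  refine ⟨(integrable_const _).sub hi, ?_⟩
  rw [integral_sub (integrable_const _) hi, h (1 - l) ⟨by linarith, by linarith⟩]
  simp

/-- Markov's inequality for the increasing function $x\mapsto 1-(1-l)^x$, whose mean is $l^\beta$.
-/
lemma tail_mul_le (h : IsSibuyaLaw β ρ) {l : ℝ} (h0 : 0 ≤ l) (h1 : l ≤ 1) (k : ℕ) :
    (1 - (1 - l) ^ k) * ρ.real (Set.Ioi k) ≤ l ^ β := by
  obtain ⟨hi, he⟩ := h.integral_one_sub h0 h1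
  rw [← he, mul_comm, ← smul_eq_mul, ← integral_indicator_const _ measurableSet_Ioi]
  refine integral_mono ((integrable_const _).indicator measurableSet_Ioi) hi fun x => ?_
  by_cases hx : x ∈ Set.Ioi k
  · rw [Set.indicator_of_mem hx]
    have := pow_le_pow_of_le_one (a := 1 - l) (by linarith) (by linarith) (le_of_lt hx)
    dsimp only
    linarith
  · rw [Set.indicator_of_notMem hx]
    have := pow_le_one₀ (a := 1 - l) (n := x) (by linarith) (by linarith)
    dsimp only
    linarith

/-- The converse bound to `tail_mul_le`: $1-(1-l)^x$ is at most 1 for $x>k$ and, by Bernoulli's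
inequality, at most $kl$ for $x\le k$. -/
lemma le_tail_add (h : IsSibuyaLaw β ρ) {l : ℝ} (h0 : 0 ≤ l) (h1 : l ≤ 1) (k : ℕ) :
    l ^ β ≤ ρ.real (Set.Ioi k) + k * l := by
  obtain ⟨hi, he⟩ := h.integral_one_sub h0 h1
  have hind : Integrable ((Set.Ioi k).indicator fun _ : ℕ => (1 : ℝ)) ρ :=
    (integrable_const _).indicator measurableSet_Ioi
  have e : ρ.real (Set.Ioi k) + k * l =
      ∫ x, ((Set.Ioi k).indicator (fun _ => (1 : ℝ)) x + k * l) ∂ρ := by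
    rw [integral_add hind (integrable_const _), integral_indicator_const _ measurableSet_Ioi]
    simp
  rw [e, ← he]
  refine integral_mono hi (hind.add (integrable_const _)) fun x => ?_
  have hl : 0 ≤ (1 - l) ^ x := pow_nonneg (by linarith) _
  have hkl : 0 ≤ k * l := by positivity
  dsimp only
  by_cases hx : x ∈ Set.Ioi k
  · rw [Set.indicator_of_mem hx]
    linarith
  · rw [Set.indicator_of_notMem hx]
    have h2 := one_add_mul_le_pow (a := -l) (by linarith) x
    have h3 : (x : ℝ) * l ≤ k * l :=
      mul_le_mul_of_nonneg_right (by exact_mod_cast not_lt.1 hx) h0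
    rw [← sub_eq_add_neg] at h2
    linarith

lemma measure_zero (h : IsSibuyaLaw β ρ) : ρ {0} = 0 := by
  have h1 := h 0 (by simp)
  -- With the convention $0^0=1$, the generating function at 0 is the mass of 0.
  have h2 : (fun k : ℕ => (0 : ℝ) ^ k) = ({0} : Set ℕ).indicator fun _ => 1 := by
    funext k
    rcases Nat.eq_zero_or_pos k with rfl | hk
    · simp
    · rw [zero_pow hk.ne', Set.indicator_of_notMem (by simpa using hk.ne')]
  rw [h2, integral_indicator_const _ (measurableSet_singleton _)] at h1
  simpa [measureReal_eq_zero_iff] using h1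

lemma tail_zero (h : IsSibuyaLaw β ρ) : ρ.real (Set.Ioi 0) = 1 := by
  have : (Set.Ioi 0 : Set ℕ) = {0}ᶜ := by ext x; simp [Nat.pos_iff_ne_zero]
  rw [this, probReal_compl_eq_one_sub (measurableSet_singleton _), measureReal_def, h.measure_zero]
  simp

end IsSibuyaLaw

/-! ### Quantile transform of the exponential distribution -/

/-- The quantile transform that maps an exponential variable to one with distribution `ρ`. -/
noncomputable def expQuantile (ρ : Measure ℕ) (e : ℝ) : ℕ :=
  sInf {k : ℕ | ρ.real (Set.Ioi k) ≤ Real.exp (-e)}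

lemma expQuantile_le_iff (ρ : Measure ℕ) [IsProbabilityMeasure ρ] (e : ℝ) (k : ℕ) :
    expQuantile ρ e ≤ k ↔ ρ.real (Set.Ioi k) ≤ Real.exp (-e) := by
  have hanti : Antitone fun k : ℕ => ρ.real (Set.Ioi k) := fun a b hab =>
    measureReal_mono (Set.Ioi_subset_Ioi hab)
  have hlim : Tendsto (fun k : ℕ => ρ.real (Set.Ioi k)) atTop (𝓝 0) := by
    have h := tendsto_measure_iInter_atTop (μ := ρ) (s := fun k : ℕ => Set.Ioi k)
      (fun k => measurableSet_Ioi.nullMeasurableSet) (fun a b hab => Set.Ioi_subset_Ioi hab)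
      ⟨0, measure_ne_top _ _⟩
    have h0 : (⋂ k : ℕ, Set.Ioi k) = ∅ := by
      ext x
      simp only [Set.mem_iInter, Set.mem_Ioi, Set.mem_empty_iff_false, iff_false, not_forall]
      exact ⟨x, lt_irrefl x⟩
    rw [h0, measure_empty] at h
    exact (ENNReal.tendsto_toReal ENNReal.zero_ne_top).comp h
  have hne : {k : ℕ | ρ.real (Set.Ioi k) ≤ Real.exp (-e)}.Nonempty :=
    (hlim.eventually_le_const (Real.exp_pos (-e))).exists
  constructor
  · intro h
    exact (hanti h).trans (Nat.sInf_mem hne)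
  · intro h
    exact Nat.sInf_le h

lemma measurable_expQuantile (ρ : Measure ℕ) [IsProbabilityMeasure ρ] :
    Measurable (expQuantile ρ) := by
  refine measurable_of_Iic fun k => ?_
  have : expQuantile ρ ⁻¹' Set.Iic k = {e | ρ.real (Set.Ioi k) ≤ Real.exp (-e)} := by
    ext e
    exact expQuantile_le_iff ρ e k
  rw [this]
  exact measurableSet_le measurable_const (by fun_prop)

instance : IsProbabilityMeasure (expMeasure 1) := isProbabilityMeasure_expMeasure one_pos

lemma expMeasure_Iic {x : ℝ} (hx : 0 ≤ x) :
    expMeasure 1 (Set.Iic x) = ENNReal.ofReal (1 - Real.exp (-x)) := by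
  rw [← ofReal_cdf, cdf_expMeasure_eq one_pos, if_pos hx, one_mul]

lemma expMeasure_Iic_zero : expMeasure 1 (Set.Iic 0) = 0 := by
  rw [expMeasure_Iic le_rfl]; simp

lemma map_expQuantile (ρ : Measure ℕ) [IsProbabilityMeasure ρ] :
    (expMeasure 1).map (expQuantile ρ) = ρ := by
  have := Measure.isProbabilityMeasure_map (μ := expMeasure 1)
    (measurable_expQuantile ρ).aemeasurable
  refine Measure.ext_of_Iic _ _ fun k => ?_
  rw [Measure.map_apply (measurable_expQuantile ρ) measurableSet_Iic]
  have h1 : expQuantile ρ ⁻¹' Set.Iic k = {e | ρ.real (Set.Ioi k) ≤ Real.exp (-e)} := by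
    ext e
    exact expQuantile_le_iff ρ e k
  have h2 : ρ (Set.Iic k) = ENNReal.ofReal (1 - ρ.real (Set.Ioi k)) := by
    rw [← probReal_compl_eq_one_sub measurableSet_Ioi, Set.compl_Ioi, ofReal_measureReal]
  rw [h1, h2]
  rcases (measureReal_nonneg (μ := ρ) (s := Set.Ioi k)).eq_or_lt with h0 | h0
  · rw [← h0]
    simp [Real.exp_nonneg]
  · have h3 : {e : ℝ | ρ.real (Set.Ioi k) ≤ Real.exp (-e)} =
        Set.Iic (-Real.log (ρ.real (Set.Ioi k))) := by
      ext e
      simp only [Set.mem_ofPred_eq, Set.mem_Iic]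
      rw [← Real.log_le_iff_le_exp h0, le_neg]
    rw [h3, expMeasure_Iic (by simpa using Real.log_nonpos h0.le measureReal_le_one), neg_neg,
      Real.exp_log h0]

/-! ### Sibuya quantiles on the logarithmic scale as the parameter tends to 0 -/

section Asymptotics

variable {β : ℕ → ℝ} {ρ : ℕ → Measure ℕ} [∀ n, IsProbabilityMeasure (ρ n)]

lemma exp_div_rpow {b y : ℝ} (hb : 0 < b) : Real.exp (y / b) ^ b = Real.exp y := by
  rw [← Real.exp_mul, div_mul_cancel₀ _ hb.ne']

lemma tendsto_exp_div (hβ : ∀ n, 0 < β n) (hβ0 : Tendsto β atTop (𝓝 0)) {y : ℝ} (hy : 0 < y) :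
    Tendsto (fun n => Real.exp (y / β n)) atTop atTop := by
  refine Real.tendsto_exp_atTop.comp ?_
  have : Tendsto (fun n => (β n)⁻¹) atTop atTop :=
    (tendsto_nhdsWithin_iff.2 ⟨hβ0, Eventually.of_forall hβ⟩).inv_tendsto_nhdsGT_zero
  simpa only [div_eq_mul_inv] using this.const_mul_atTop hy

lemma tendsto_const_rpow (hβ0 : Tendsto β atTop (𝓝 0)) {c : ℝ} (hc : 0 < c) :
    Tendsto (fun n => c ^ β n) atTop (𝓝 1) := by
  have := (Real.continuousAt_const_rpow hc.ne' (b := 0)).tendsto.comp hβ0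
  rwa [Real.rpow_zero] at this

/-- Apply `le_tail_add` with $l=\varepsilon/X$, $X=e^{y/\beta}$. Then $l^\beta=\varepsilon^\beta
e^{-y}\to e^{-y}$, while the error $\lfloor X\rfloor l$ is at most $\varepsilon$. -/
lemma eventually_lt_tail (hβ : ∀ n, 0 < β n) (hβ0 : Tendsto β atTop (𝓝 0))
    (hρ : ∀ n, IsSibuyaLaw (β n) (ρ n)) {y e : ℝ} (hy : 0 < y) (hye : y < e) :
    ∀ᶠ n in atTop, Real.exp (-e) < (ρ n).real (Set.Ioi ⌊Real.exp (y / β n)⌋₊) := by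
  -- Half the gap, so that $e^{-y}-\varepsilon$ still exceeds $e^{-e}$.
  set ε := (Real.exp (-y) - Real.exp (-e)) / 2 with hε
  have h1 : Real.exp (-e) < Real.exp (-y) := Real.exp_lt_exp.2 (by linarith)
  have hεpos : 0 < ε := by linarith
  have hε1 : ε ≤ 1 := by
    have := Real.exp_le_one_iff.2 (show -y ≤ 0 by linarith)
    have := Real.exp_pos (-e)
    linarith
  have hlim : Tendsto (fun n => ε ^ β n * Real.exp (-y) - ε) atTop (𝓝 (1 * Real.exp (-y) - ε)) :=
    ((tendsto_const_rpow hβ0 hεpos).mul_const _).sub_const _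
  filter_upwards [hlim.eventually_const_lt (show Real.exp (-e) < 1 * Real.exp (-y) - ε by linarith)]
    with n hn
  refine hn.trans_le ?_
  set X := Real.exp (y / β n) with hX
  have hX1 : 1 ≤ X := Real.one_le_exp (div_nonneg hy.le (hβ n).le)
  have hX0 : 0 < X := by linarith
  have h2 := (hρ n).le_tail_add (l := ε / X) (by positivity)
    ((div_le_one hX0).2 (hε1.trans hX1)) ⌊X⌋₊
  have h3 : (⌊X⌋₊ : ℝ) * (ε / X) ≤ ε := by
    calc (⌊X⌋₊ : ℝ) * (ε / X) ≤ X * (ε / X) :=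
          mul_le_mul_of_nonneg_right (Nat.floor_le hX0.le) (by positivity)
      _ = ε := by field_simp
  rw [Real.div_rpow hεpos.le hX0.le, exp_div_rpow (hβ n), div_eq_mul_inv, ← Real.exp_neg] at h2
  linarith

/-- Apply `tail_mul_le` with $l=C/X$, $X=e^{y/\beta}$. Again $l^\beta\to e^{-y}$, and
$(1-l)^{\lfloor X\rfloor}\le e^{-C/2}$ is negligible for large $C$. -/
lemma eventually_tail_lt (hβ : ∀ n, 0 < β n) (hβ0 : Tendsto β atTop (𝓝 0))
    (hρ : ∀ n, IsSibuyaLaw (β n) (ρ n)) {y e : ℝ} (hy : 0 < y) (hye : e < y) :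
    ∀ᶠ n in atTop, (ρ n).real (Set.Ioi ⌊Real.exp (y / β n)⌋₊) < Real.exp (-e) := by
  have h1 : Real.exp (-y) < Real.exp (-e) := Real.exp_lt_exp.2 (by linarith)
  have hlimC : Tendsto (fun C : ℝ => Real.exp (-y) / (1 - Real.exp (-(C / 2)))) atTop
      (𝓝 (Real.exp (-y) / (1 - 0))) := by
    refine Tendsto.div tendsto_const_nhds (tendsto_const_nhds.sub ?_) (by norm_num)
    exact Real.tendsto_exp_neg_atTop_nhds_zero.comp (tendsto_id.atTop_div_const (by norm_num))
  obtain ⟨C, hC, hCpos⟩ := ((hlimC.eventually_lt_const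
    (show Real.exp (-y) / (1 - 0) < Real.exp (-e) by simpa using h1)).and
    (eventually_gt_atTop 0)).exists
  have hd : 0 < 1 - Real.exp (-(C / 2)) := by
    have : Real.exp (-(C / 2)) < 1 := Real.exp_lt_one_iff.2 (by linarith)
    linarith
  have hlim : Tendsto (fun n => C ^ β n * Real.exp (-y) / (1 - Real.exp (-(C / 2)))) atTop
      (𝓝 (1 * Real.exp (-y) / (1 - Real.exp (-(C / 2))))) :=
    ((tendsto_const_rpow hβ0 hCpos).mul_const _).div_const _
  rw [one_mul] at hlim
  filter_upwards [hlim.eventually_lt_const hC,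
    (tendsto_exp_div hβ hβ0 hy).eventually_ge_atTop (max 2 C)] with n hn hX
  refine lt_of_le_of_lt ?_ hn
  set X := Real.exp (y / β n) with hXdef
  have hX2 : 2 ≤ X := (le_max_left _ _).trans hX
  have hX0 : 0 < X := by linarith
  have hl0 : 0 ≤ C / X := by positivity
  have hl1 : C / X ≤ 1 := (div_le_one hX0).2 ((le_max_right _ _).trans hX)
  have h2 := (hρ n).tail_mul_le hl0 hl1 ⌊X⌋₊
  rw [Real.div_rpow hCpos.le hX0.le, exp_div_rpow (hβ n), div_eq_mul_inv (C ^ β n),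
    ← Real.exp_neg] at h2
  rw [le_div_iff₀ hd, mul_comm]
  refine le_trans (mul_le_mul_of_nonneg_right ?_ measureReal_nonneg) h2
  have h3 : (1 - C / X) ^ ⌊X⌋₊ ≤ Real.exp (-(C / 2)) := by
    calc (1 - C / X) ^ ⌊X⌋₊ ≤ Real.exp (-(C / X)) ^ ⌊X⌋₊ :=
          pow_le_pow_left₀ (by linarith) (Real.one_sub_le_exp_neg _) _
      _ = Real.exp (-(⌊X⌋₊ * (C / X))) := by rw [← Real.exp_nat_mul, mul_neg]
      _ ≤ Real.exp (-(C / 2)) := by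
          refine Real.exp_le_exp.2 (neg_le_neg ?_)
          -- The floor exceeds $X-1$, and $X\ge 2$; this is the origin of the 2 in $C/2$.
          have hf : X / 2 ≤ ⌊X⌋₊ := by
            have := Nat.lt_floor_add_one X
            linarith
          calc C / 2 = X / 2 * (C / X) := by field_simp
            _ ≤ ⌊X⌋₊ * (C / X) := mul_le_mul_of_nonneg_right hf hl0
  linarith

/-- Rescaled logarithms of Sibuya quantiles converge to the exponential variable. -/
lemma tendsto_mul_log_expQuantile (hβ : ∀ n, 0 < β n) (hβ0 : Tendsto β atTop (𝓝 0))
    (hρ : ∀ n, IsSibuyaLaw (β n) (ρ n)) {e : ℝ} (he : 0 < e) :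
    Tendsto (fun n => β n * Real.log (expQuantile (ρ n) e)) atTop (𝓝 e) := by
  rw [tendsto_order]
  constructor
  · intro a ha
    -- The maximum with 0 makes `y` positive, as the tail estimate requires, even if `a` is
    -- negative.
    obtain ⟨y, hy1, hy2⟩ := exists_between (max_lt ha he)
    have hy0 : 0 < y := (le_max_right _ _).trans_lt hy1
    filter_upwards [eventually_lt_tail hβ hβ0 hρ hy0 hy2] with n hn
    have h1 : ⌊Real.exp (y / β n)⌋₊ < expQuantile (ρ n) e := by
      rw [← not_le, expQuantile_le_iff, not_le]
      exact hn
    have h2 : Real.exp (y / β n) < expQuantile (ρ n) e := (Nat.floor_lt (Real.exp_pos _).le).1 h1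
    have h3 : y / β n < Real.log (expQuantile (ρ n) e) :=
      (Real.lt_log_iff_exp_lt ((Real.exp_pos _).trans h2)).2 h2
    rw [div_lt_iff₀' (hβ n)] at h3
    exact ((le_max_left _ _).trans_lt hy1).trans h3
  · intro a ha
    obtain ⟨y, hy1, hy2⟩ := exists_between ha
    have hy0 : 0 < y := he.trans hy1
    filter_upwards [eventually_tail_lt hβ hβ0 hρ hy0 hy1] with n hn
    have h1 := (expQuantile_le_iff (ρ n) e ⌊Real.exp (y / β n)⌋₊).2 hn.le
    have h2 : (expQuantile (ρ n) e : ℝ) ≤ Real.exp (y / β n) :=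
      (Nat.le_floor_iff (Real.exp_pos _).le).1 h1
    refine lt_of_le_of_lt ?_ hy2
    rw [← le_div_iff₀' (hβ n)]
    rcases Nat.eq_zero_or_pos (expQuantile (ρ n) e) with h0 | h0
    · rw [h0]
      simpa using div_nonneg hy0.le (hβ n).le
    · exact (Real.log_le_iff_le_exp (by exact_mod_cast h0)).2 h2

end Asymptotics

lemma IsSibuyaLaw.expQuantile_pos {β : ℝ} {ρ : Measure ℕ} [IsProbabilityMeasure ρ]
    (h : IsSibuyaLaw β ρ) {e : ℝ} (he : 0 < e) : 0 < expQuantile ρ e := by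
  rw [← not_le, expQuantile_le_iff, h.tail_zero, not_le]
  exact Real.exp_lt_one_iff.2 (by linarith)

/-! ### Sums and running maxima -/

/-- Starting from `x`, the running maximum of a sequence. -/
def maxWalk (x : ℝ) (e : ℕ → ℝ) : ℕ → ℝ
  | 0 => x
  | j + 1 => max (maxWalk x e j) (e j)

lemma maxWalk_succ' (x : ℝ) (e : ℕ → ℝ) (j : ℕ) :
    maxWalk x e (j + 1) = maxWalk (max x (e 0)) (fun i => e (i + 1)) j := by
  induction j with
  | zero => rfl
  | succ j ih => rw [maxWalk, ih, maxWalk]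

lemma monotone_maxWalk (x : ℝ) (e : ℕ → ℝ) : Monotone (maxWalk x e) :=
  monotone_nat_of_le_succ fun _ => le_max_left _ _

lemma le_maxWalk (x : ℝ) (e : ℕ → ℝ) (j : ℕ) : e j ≤ maxWalk x e (j + 1) := le_max_right _ _

/-- On the logarithmic scale the sum of natural numbers is governed by their maximum. -/
lemma tendsto_mul_log_sum {β : ℕ → ℝ} (hβ : ∀ n, 0 < β n) (hβ0 : Tendsto β atTop (𝓝 0))
    {a : ℕ → ℕ → ℕ} {e : ℕ → ℝ} (ha : ∀ n i, 0 < a n i)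
    (hlim : ∀ i, Tendsto (fun n => β n * Real.log (a n i)) atTop (𝓝 (e i))) (j : ℕ) :
    Tendsto (fun n => β n * Real.log ((∑ i ∈ Finset.range (j + 1), a n i : ℕ) : ℝ)) atTop
      (𝓝 (maxWalk (e 0) (fun i => e (i + 1)) j)) := by
  induction j with
  | zero => simpa [maxWalk] using hlim 0
  | succ j ih =>
    have hmax := ih.max (hlim (j + 1))
    -- A sum of two terms is at most twice their maximum, and the cost `β n * Real.log 2` vanishes
    -- in the limit.
    have hup : Tendsto (fun n => β n * Real.log 2 +
        max (β n * Real.log ((∑ i ∈ Finset.range (j + 1), a n i : ℕ) : ℝ))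
          (β n * Real.log (a n (j + 1)))) atTop
        (𝓝 (0 * Real.log 2 + max (maxWalk (e 0) (fun i => e (i + 1)) j) (e (j + 1)))) :=
      (hβ0.mul_const _).add hmax
    rw [zero_mul, zero_add] at hup
    refine tendsto_of_tendsto_of_tendsto_of_le_of_le hmax hup (fun n => ?_) fun n => ?_
    all_goals
      have hA : (0 : ℝ) < ((∑ i ∈ Finset.range (j + 1), a n i : ℕ) : ℝ) := by
        exact_mod_cast Finset.sum_pos (fun i _ => ha n i) ⟨0, by simp⟩
      have hB : (0 : ℝ) < a n (j + 1) := by exact_mod_cast ha n (j + 1)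
      dsimp only
      rw [Finset.sum_range_succ _ (j + 1)]
      set A := ∑ i ∈ Finset.range (j + 1), a n i
      push_cast
      rw [← mul_max_of_nonneg _ _ (hβ n).le]
    · refine mul_le_mul_of_nonneg_left (max_le ?_ ?_) (hβ n).le
      · exact Real.log_le_log hA (by linarith)
      · exact Real.log_le_log hB (by linarith)
    · rw [← mul_add]
      refine mul_le_mul_of_nonneg_left ?_ (hβ n).le
      rcases le_total (A : ℝ) (a n (j + 1)) with h | h
      · rw [max_eq_right (Real.log_le_log hA h), ← Real.log_mul two_ne_zero hB.ne']
        exact Real.log_le_log (by linarith) (by linarith)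
      · rw [max_eq_left (Real.log_le_log hB h), ← Real.log_mul two_ne_zero hA.ne']
        exact Real.log_le_log (by linarith) (by linarith)

/-! ### Laws of i.i.d. sequences -/

section IidSequences

variable {X : Type*} [MeasurableSpace X]

/-- The sequence `x, e 0, e 1, …`. -/
def consSeq (x : X) (e : ℕ → X) : ℕ → X
  | 0 => x
  | n + 1 => e n

lemma measurable_consSeq : Measurable fun p : X × (ℕ → X) => consSeq p.1 p.2 := by
  refine measurable_pi_iff.2 fun n => ?_
  cases n with
  | zero => exact measurable_fst
  | succ n => exact (measurable_pi_apply n).comp measurable_snd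

/-- A finite measure on sequences is determined by its values on finite-dimensional boxes. -/
lemma ext_of_boxes {m₁ m₂ : Measure (ℕ → X)} [IsFiniteMeasure m₁]
    (h : ∀ (N : ℕ) (t : ℕ → Set X), (∀ i, MeasurableSet (t i)) →
      m₁ {e | ∀ i < N, e i ∈ t i} = m₂ {e | ∀ i < N, e i ∈ t i}) : m₁ = m₂ := by
  classical
  refine ext_of_generate_finite
    (squareCylinders fun _ : ℕ => {s : Set X | MeasurableSet s}) ?_ ?_ ?_ ?_
  · exact (generateFrom_squareCylinders (α := fun _ : ℕ => X)).symm
  · exact isPiSystem_squareCylinders (fun _ => MeasurableSpace.isPiSystem_measurableSet)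
      fun _ => MeasurableSet.univ
  · rintro _ ⟨s, t, ht, rfl⟩
    obtain ⟨N, hN⟩ := s.exists_nat_subset_range
    have h1 := h N (fun i => if i ∈ s then t i else Set.univ) (fun i => by
      split_ifs
      · exact ht i trivial
      · exact MeasurableSet.univ)
    have h2 : {e : ℕ → X | ∀ i < N, e i ∈ if i ∈ s then t i else Set.univ} =
        Set.pi (s : Set ℕ) t := by
      ext e
      constructor
      · intro he i hi
        have := he i (Finset.mem_range.1 (hN hi))
        rwa [if_pos (Finset.mem_coe.1 hi)] at this
      · intro he i _
        split_ifs with hi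
        · exact he i hi
        · trivial
    rwa [h2] at h1
  · simpa using h 0 (fun _ => Set.univ) fun _ => MeasurableSet.univ

/-- The law of an i.i.d. sequence. -/
noncomputable def iidLaw (ν : Measure X) [IsProbabilityMeasure ν] : Measure (ℕ → X) :=
  Measure.infinitePi fun _ => ν

variable (ν : Measure X) [IsProbabilityMeasure ν]

instance : IsProbabilityMeasure (iidLaw ν) :=
  inferInstanceAs (IsProbabilityMeasure (Measure.infinitePi fun _ : ℕ => ν))

lemma iidLaw_box (N : ℕ) (t : ℕ → Set X) (ht : ∀ i, MeasurableSet (t i)) :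
    iidLaw ν {e | ∀ i < N, e i ∈ t i} = ∏ i ∈ Finset.range N, ν (t i) := by
  have h : {e : ℕ → X | ∀ i < N, e i ∈ t i} = Set.pi (Finset.range N : Set ℕ) t := by
    ext e
    simp [Set.mem_pi]
  rw [h, iidLaw, Measure.infinitePi_pi (fun _ => ν) fun i _ => ht i]

lemma eq_iidLaw_of_range {m : Measure (ℕ → X)}
    (h : ∀ (N : ℕ) (t : ℕ → Set X), (∀ i, MeasurableSet (t i)) →
      m {e | ∀ i < N, e i ∈ t i} = ∏ i ∈ Finset.range N, ν (t i)) : m = iidLaw ν :=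
  (ext_of_boxes fun N t ht => (iidLaw_box ν N t ht).trans (h N t ht).symm).symm

lemma map_consSeq : (ν.prod (iidLaw ν)).map (fun p => consSeq p.1 p.2) = iidLaw ν := by
  refine eq_iidLaw_of_range ν fun N t ht => ?_
  have hm : MeasurableSet {e : ℕ → X | ∀ i < N, e i ∈ t i} := by
    simp_rw [Set.ofPred_forall]
    exact MeasurableSet.iInter fun i => MeasurableSet.iInter fun _ =>
      measurable_pi_apply i (ht i)
  rw [Measure.map_apply measurable_consSeq hm]
  cases N with
  | zero => simp
  | succ N =>
    have h : (fun p : X × (ℕ → X) => consSeq p.1 p.2) ⁻¹' {e | ∀ i < N + 1, e i ∈ t i} =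
        t 0 ×ˢ {e | ∀ i < N, e i ∈ t (i + 1)} := by
      ext p
      constructor
      · intro hp
        exact ⟨hp 0 (Nat.succ_pos _), fun i hi => hp (i + 1) (Nat.succ_lt_succ hi)⟩
      · rintro ⟨h0, h1⟩ i hi
        cases i with
        | zero => exact h0
        | succ i => exact h1 i (Nat.lt_of_succ_lt_succ hi)
    rw [h, Measure.prod_prod, iidLaw_box ν N (fun i => t (i + 1)) fun i => ht _,
      Finset.prod_range_succ', mul_comm]

/-- Conditioning on the first term, the remaining sequence has the original law; all first-step
recursions below start here. -/
lemma lintegral_iidLaw {F : (ℕ → X) → ℝ≥0∞} (hF : Measurable F) :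
    ∫⁻ e, F e ∂(iidLaw ν) = ∫⁻ x, ∫⁻ e, F (consSeq x e) ∂(iidLaw ν) ∂ν := by
  conv_lhs => rw [← map_consSeq ν]
  rw [lintegral_map hF measurable_consSeq]
  exact lintegral_prod _ (hF.comp measurable_consSeq).aemeasurable

lemma map_iidLaw {Y : Type*} [MeasurableSpace Y] {f : X → Y} (hf : Measurable f)
    {ρ : Measure Y} [IsProbabilityMeasure ρ] (h : ν.map f = ρ) :
    (iidLaw ν).map (fun e i => f (e i)) = iidLaw ρ := by
  subst h
  exact Measure.infinitePi_map_pi (fun _ => ν) fun _ => hf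

lemma map_eval_iidLaw (i : ℕ) : (iidLaw ν).map (fun e => e i) = ν :=
  Measure.infinitePi_map_eval (fun _ => ν) i

lemma ae_iidLaw {p : X → Prop} (hp : ∀ᵐ x ∂ν, p x) : ∀ᵐ e ∂(iidLaw ν), ∀ i, p (e i) := by
  refine ae_all_iff.2 fun i => ?_
  refine ae_of_ae_map (f := fun e : ℕ → X => e i) (measurable_pi_apply i).aemeasurable ?_
  rwa [map_eval_iidLaw]

end IidSequences

/-! ### Block sums, random sums and composition of Sibuya laws -/

section BlockSums

/-- The sums of `D` over consecutive blocks of lengths `L 0, L 1, …`. -/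
def blockSum (L D : ℕ → ℕ) (j : ℕ) : ℕ :=
  ∑ i ∈ Finset.range (L j), D (i + ∑ m ∈ Finset.range j, L m)

lemma blockSum_succ (L D : ℕ → ℕ) (j : ℕ) :
    blockSum L D (j + 1) = blockSum (fun i => L (i + 1)) (fun i => D (i + L 0)) j := by
  simp only [blockSum, Finset.sum_range_succ' L j, add_assoc]

lemma sum_blockSum (L D : ℕ → ℕ) (j : ℕ) :
    ∑ i ∈ Finset.range j, blockSum L D i = ∑ i ∈ Finset.range (∑ m ∈ Finset.range j, L m), D i := by
  induction j with
  | zero => simp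
  | succ j ih =>
    rw [Finset.sum_range_succ, ih, Finset.sum_range_succ L, Finset.sum_range_add, blockSum]
    simp_rw [add_comm]

lemma measurable_shift {Y : Type*} [MeasurableSpace Y] {f : Y → ℕ → ℕ} {l : Y → ℕ}
    (hf : ∀ i, Measurable fun y => f y i) (hl : Measurable l) (i : ℕ) :
    Measurable fun y => f y (i + l y) := by
  have h : Measurable fun p : (ℕ → ℕ) × ℕ => p.1 (i + p.2) :=
    measurable_from_prod_countable_left fun l => measurable_pi_apply (i + l)
  exact h.comp ((measurable_pi_iff.2 hf).prodMk hl)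

lemma measurable_randomSum {Y : Type*} [MeasurableSpace Y] {f : Y → ℕ → ℕ} {l : Y → ℕ}
    (hf : ∀ i, Measurable fun y => f y i) (hl : Measurable l) :
    Measurable fun y => ∑ i ∈ Finset.range (l y), f y i := by
  have h : Measurable fun p : (ℕ → ℕ) × ℕ => ∑ i ∈ Finset.range p.2, p.1 i :=
    measurable_from_prod_countable_left fun l =>
      Finset.measurable_fun_sum (Finset.range l) (f := fun i (D : ℕ → ℕ) => D i)
        fun i _ => measurable_pi_apply i
  exact h.comp ((measurable_pi_iff.2 hf).prodMk hl)

lemma measurable_blockSum {Y : Type*} [MeasurableSpace Y] {L D : Y → ℕ → ℕ}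
    (hL : ∀ i, Measurable fun y => L y i) (hD : ∀ i, Measurable fun y => D y i) (j : ℕ) :
    Measurable fun y => blockSum (L y) (D y) j :=
  measurable_randomSum (fun i => measurable_shift hD
    (Finset.measurable_fun_sum _ fun m _ => hL m) i) (hL j)

variable (ρ₁ ρ₂ : Measure ℕ) [IsProbabilityMeasure ρ₁]

/-- The sum of the first `l` terms of an i.i.d. sequence is independent of the later terms, which
form an i.i.d. sequence with the same law. -/
lemma lintegral_sum_mul_shift (l : ℕ) (a : ℕ → ℝ≥0∞) {b : (ℕ → ℕ) → ℝ≥0∞} (hb : Measurable b) :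
    ∫⁻ D, a (∑ i ∈ Finset.range l, D i) * b (fun i => D (i + l)) ∂(iidLaw ρ₁) =
      (∫⁻ D, a (∑ i ∈ Finset.range l, D i) ∂(iidLaw ρ₁)) * ∫⁻ D, b D ∂(iidLaw ρ₁) := by
  have ha : ∀ (l : ℕ) (a : ℕ → ℝ≥0∞),
      Measurable fun D : ℕ → ℕ => a (∑ i ∈ Finset.range l, D i) := fun l a =>
    measurable_from_top.comp (Finset.measurable_fun_sum _ fun i _ => measurable_pi_apply i)
  have hbl : ∀ l : ℕ, Measurable fun D : ℕ → ℕ => b (fun i => D (i + l)) := fun l =>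
    hb.comp (measurable_pi_iff.2 fun i => measurable_pi_apply (i + l))
  induction l generalizing a with
  | zero => simp [lintegral_const_mul _ hb]
  | succ l ih =>
    have hab : Measurable fun D : ℕ → ℕ =>
        a (∑ i ∈ Finset.range (l + 1), D i) * b (fun i => D (i + (l + 1))) :=
      (ha _ _).mul (hbl _)
    rw [lintegral_iidLaw ρ₁ hab, lintegral_iidLaw ρ₁ (ha _ _)]
    rw [← lintegral_mul_const _ measurable_from_top]
    refine lintegral_congr fun x => ?_
    -- The first term is absorbed into the function of the sum, which is why the induction runs over
    -- all `a`.
    have h := ih fun k => a (k + x)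
    simp_rw [Finset.sum_range_succ' _ l]
    exact h

/-- The law of a random sum. -/
noncomputable def randomSumLaw : Measure ℕ :=
  (ρ₂.prod (iidLaw ρ₁)).map fun p => ∑ i ∈ Finset.range p.1, p.2 i

lemma measurable_randomSum' :
    Measurable fun p : ℕ × (ℕ → ℕ) => ∑ i ∈ Finset.range p.1, p.2 i :=
  measurable_randomSum (fun i => (measurable_pi_apply i).comp measurable_snd) measurable_fst

lemma lintegral_randomSumLaw (a : ℕ → ℝ≥0∞) :
    ∫⁻ k, a k ∂(randomSumLaw ρ₁ ρ₂) =
      ∫⁻ l, ∫⁻ D, a (∑ i ∈ Finset.range l, D i) ∂(iidLaw ρ₁) ∂ρ₂ := by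
  rw [randomSumLaw, lintegral_map measurable_from_top measurable_randomSum']
  exact lintegral_prod _ (measurable_from_top.comp measurable_randomSum').aemeasurable

variable [IsProbabilityMeasure ρ₂]

instance : IsProbabilityMeasure (randomSumLaw ρ₁ ρ₂) :=
  Measure.isProbabilityMeasure_map measurable_randomSum'.aemeasurable

/-- Block sums of an i.i.d. sequence over independent i.i.d. block lengths are i.i.d. -/
lemma map_blockSum :
    ((iidLaw ρ₂).prod (iidLaw ρ₁)).map (fun p => blockSum p.1 p.2) =
      iidLaw (randomSumLaw ρ₁ ρ₂) := by
  have hmeas : Measurable fun p : (ℕ → ℕ) × (ℕ → ℕ) => blockSum p.1 p.2 :=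
    measurable_pi_iff.2 fun j => measurable_blockSum
      (fun i => (measurable_pi_apply i).comp measurable_fst)
      (fun i => (measurable_pi_apply i).comp measurable_snd) j
  have hset : ∀ (N : ℕ) (t : ℕ → Set ℕ), MeasurableSet {e : ℕ → ℕ | ∀ i < N, e i ∈ t i} := by
    intro N t
    simp_rw [Set.ofPred_forall]
    exact MeasurableSet.iInter fun i => MeasurableSet.iInter fun _ =>
      measurable_pi_apply i (MeasurableSet.of_discrete)
  refine eq_iidLaw_of_range _ fun N t _ => ?_
  rw [Measure.map_apply hmeas (hset N t)]
  induction N generalizing t with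
  | zero => simp
  | succ N ih =>
    set g : (ℕ → ℕ) × (ℕ → ℕ) → ℝ≥0∞ :=
      ((fun p => blockSum p.1 p.2) ⁻¹' {e | ∀ i < N, e i ∈ t (i + 1)}).indicator 1 with hg
    have hgm : Measurable g := measurable_one.indicator (hmeas (hset N fun i => t (i + 1)))
    have hgi : ∫⁻ L, ∫⁻ D, g (L, D) ∂(iidLaw ρ₁) ∂(iidLaw ρ₂) =
        ∏ i ∈ Finset.range N, randomSumLaw ρ₁ ρ₂ (t (i + 1)) := by
      rw [← ih (fun i => t (i + 1)) fun _ => MeasurableSet.of_discrete, ← lintegral_prod _ hgm.aemeasurable, hg,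
        lintegral_indicator_one (hmeas (hset N fun i => t (i + 1)))]
    -- Given the first block length `l`, the first block uses only the first `l` terms of `D`; the
    -- other blocks are block sums of the shifted sequence, which is independent of it.
    have hsplit : ∀ (l : ℕ) (L D : ℕ → ℕ),
        ((fun p : (ℕ → ℕ) × (ℕ → ℕ) => blockSum p.1 p.2) ⁻¹'
          {e | ∀ i < N + 1, e i ∈ t i}).indicator (1 : (ℕ → ℕ) × (ℕ → ℕ) → ℝ≥0∞)
          (consSeq l L, D) =
        (t 0).indicator 1 (∑ i ∈ Finset.range l, D i) * g (L, fun i => D (i + l)) := by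
      intro l L D
      have h0 : blockSum (consSeq l L) D 0 = ∑ i ∈ Finset.range l, D i := by
        simp [blockSum, consSeq]
      have h1 : ∀ j, blockSum (consSeq l L) D (j + 1) = blockSum L (fun i => D (i + l)) j :=
        fun j => blockSum_succ _ _ j
      have h2 : (∀ i < N + 1, blockSum (consSeq l L) D i ∈ t i) ↔
          (∑ i ∈ Finset.range l, D i ∈ t 0) ∧
            ∀ i < N, blockSum L (fun i => D (i + l)) i ∈ t (i + 1) := by
        constructor
        · intro h
          exact ⟨h0 ▸ h 0 (Nat.succ_pos _), fun i hi => h1 i ▸ h (i + 1) (Nat.succ_lt_succ hi)⟩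
        · rintro ⟨ha, hb⟩ i hi
          cases i with
          | zero => rwa [h0]
          | succ i => rw [h1]; exact hb i (Nat.lt_of_succ_lt_succ hi)
      classical
      simp only [hg, Set.indicator_apply, Set.mem_preimage, Set.mem_ofPred_eq, Pi.one_apply, h2]
      by_cases ha : ∑ i ∈ Finset.range l, D i ∈ t 0 <;>
      by_cases hb : ∀ i < N, blockSum L (fun i => D (i + l)) i ∈ t (i + 1) <;>
        simp [ha, hb]
    rw [← lintegral_indicator_one (hmeas (hset (N + 1) t)),
      lintegral_prod _ (measurable_one.indicator (hmeas (hset (N + 1) t))).aemeasurable,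
      lintegral_iidLaw ρ₂ (Measurable.lintegral_prod_right'
        (measurable_one.indicator (hmeas (hset (N + 1) t))))]
    simp_rw [hsplit]
    have hin : ∀ l (L : ℕ → ℕ), ∫⁻ D, (t 0).indicator 1 (∑ i ∈ Finset.range l, D i) *
        g (L, fun i => D (i + l)) ∂(iidLaw ρ₁) =
        (∫⁻ D, (t 0).indicator 1 (∑ i ∈ Finset.range l, D i) ∂(iidLaw ρ₁)) *
          ∫⁻ D, g (L, D) ∂(iidLaw ρ₁) := fun l L =>
      lintegral_sum_mul_shift ρ₁ l _ (b := fun D => g (L, D)) (hgm.comp measurable_prodMk_left)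
    simp_rw [hin, lintegral_const_mul _ hgm.lintegral_prod_right', hgi]
    rw [lintegral_mul_const _ measurable_from_top, ← lintegral_randomSumLaw,
      lintegral_indicator_one MeasurableSet.of_discrete, Finset.prod_range_succ', mul_comm]

lemma lintegral_pow_sum (s : ℝ≥0∞) (l : ℕ) :
    ∫⁻ D, s ^ (∑ i ∈ Finset.range l, D i) ∂(iidLaw ρ₁) = (∫⁻ k, s ^ k ∂ρ₁) ^ l := by
  induction l with
  | zero => simp
  | succ l ih =>
    have hm : ∀ l, Measurable fun e : ℕ → ℕ => s ^ (∑ i ∈ Finset.range l, e i) := fun l =>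
      (measurable_from_top (f := fun k : ℕ => s ^ k)).comp
        (Finset.measurable_fun_sum _ fun i _ => measurable_pi_apply i)
    rw [lintegral_iidLaw ρ₁ (hm _)]
    simp_rw [Finset.sum_range_succ' _ l, pow_add]
    change ∫⁻ x, ∫⁻ e, s ^ (∑ i ∈ Finset.range l, e i) * s ^ x ∂(iidLaw ρ₁) ∂ρ₁ = _
    simp_rw [lintegral_mul_const _ (hm l)]
    rw [lintegral_const_mul _ measurable_from_top, ih, pow_one]

variable {ρ₁ ρ₂}

/-- Nonnegativity of `β` keeps $1-(1-t)^\beta$ nonnegative, so `ENNReal.ofReal` does not truncate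
it. -/
lemma isSibuyaLaw_iff_lintegral {β : ℝ} (hβ : 0 ≤ β) :
    IsSibuyaLaw β ρ₁ ↔ ∀ t ∈ Set.Icc (0 : ℝ) 1,
      ∫⁻ k, ENNReal.ofReal t ^ k ∂ρ₁ = ENNReal.ofReal (1 - (1 - t) ^ β) := by
  refine forall₂_congr fun t ht => ?_
  have hi : Integrable (fun k : ℕ => t ^ k) ρ₁ := by
    refine Integrable.of_bound (C := 1) measurable_from_top.aestronglyMeasurable
      (Eventually.of_forall fun k => ?_)
    rw [norm_pow, Real.norm_eq_abs, abs_of_nonneg ht.1]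
    exact pow_le_one₀ ht.1 ht.2
  have hn : ∀ k : ℕ, 0 ≤ t ^ k := fun k => pow_nonneg ht.1 k
  have h0 : 0 ≤ ∫ k, t ^ k ∂ρ₁ := integral_nonneg hn
  have h1 : 0 ≤ 1 - (1 - t) ^ β :=
    sub_nonneg.2 (Real.rpow_le_one (by linarith [ht.2]) (by linarith [ht.1]) hβ)
  have h2 : ENNReal.ofReal (∫ k, t ^ k ∂ρ₁) = ∫⁻ k, ENNReal.ofReal t ^ k ∂ρ₁ := by
    rw [ofReal_integral_eq_lintegral_ofReal hi (Eventually.of_forall hn)]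
    simp_rw [ENNReal.ofReal_pow ht.1]
  rw [← h2, ENNReal.ofReal_eq_ofReal_iff h0 h1]

/-- The generating function of a random sum is that of the number of terms evaluated at that of a
term, and $1-\bigl(1-[1-(1-t)^\beta]\bigr)^\alpha=1-(1-t)^{\beta\alpha}$. -/
lemma IsSibuyaLaw.randomSumLaw {β α : ℝ} (hβ : 0 ≤ β) (hα : 0 ≤ α) (h₁ : IsSibuyaLaw β ρ₁)
    (h₂ : IsSibuyaLaw α ρ₂) : IsSibuyaLaw (β * α) (randomSumLaw ρ₁ ρ₂) := by
  rw [isSibuyaLaw_iff_lintegral (mul_nonneg hβ hα)]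
  intro t ht
  have ht' : 0 ≤ 1 - t := by linarith [ht.2]
  have hr0 : 0 ≤ (1 - t) ^ β := Real.rpow_nonneg ht' _
  have hr1 : (1 - t) ^ β ≤ 1 := Real.rpow_le_one ht' (by linarith [ht.1]) hβ
  rw [lintegral_randomSumLaw]
  simp_rw [lintegral_pow_sum, (isSibuyaLaw_iff_lintegral hβ).1 h₁ t ht]
  rw [(isSibuyaLaw_iff_lintegral hα).1 h₂ _ ⟨by linarith, by linarith⟩, sub_sub_cancel,
    ← Real.rpow_mul ht']

end BlockSums

/-! ### Combinatorics of the election: survivors and gaps -/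

namespace LeaderElection

/-- The gaps between the original numbers of the survivors of `n` rounds. -/
def survivorGap (x : ℕ → ℕ → ℕ) : ℕ → ℕ → ℕ
  | 0 => fun _ => 1
  | n + 1 => blockSum (x n) (survivorGap x n)

/-- The sum of the first `j` gaps. -/
def gapSum (x : ℕ → ℕ → ℕ) (n j : ℕ) : ℕ := ∑ i ∈ Finset.range j, survivorGap x n i

/-- Before round `n + 1` the player who becomes number `j` carries the label `walk x n j`. -/
lemma gapSum_succ_round (x : ℕ → ℕ → ℕ) (n j : ℕ) :
    gapSum x (n + 1) j = gapSum x n (walk x n j) :=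
  sum_blockSum _ _ _

variable {x : ℕ → ℕ → ℕ} (hx : ∀ n k, 0 < x n k)

include hx in
lemma survivorGap_pos (n i : ℕ) : 0 < survivorGap x n i := by
  induction n generalizing i with
  | zero => exact one_pos
  | succ n ih =>
    exact Finset.sum_pos (fun j _ => ih _) (Finset.nonempty_range_iff.2 (hx n i).ne')

include hx in
lemma strictMono_gapSum (n : ℕ) : StrictMono (gapSum x n) :=
  strictMono_nat_of_lt_succ fun j => by
    rw [gapSum, gapSum, Finset.sum_range_succ]
    exact Nat.lt_add_of_pos_right (survivorGap_pos hx n j)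

include hx in
-- The counting function and the positions of the survivors are inverse to each other. Since
-- positions increase strictly, those up to `M` have the indices of an initial segment, and counting
-- this segment carries the relation to the next round.
lemma le_survivors_iff (n M j : ℕ) : j ≤ survivors x n M ↔ gapSum x n j ≤ M := by
  induction n generalizing M j with
  | zero => simp [survivors, gapSum, survivorGap]
  | succ n ih =>
    have hmono := strictMono_gapSum hx (n + 1)
    have hset : {i : ℕ | 1 ≤ i ∧ walk x n i ≤ survivors x n M} =
        {i : ℕ | 1 ≤ i ∧ gapSum x (n + 1) i ≤ M} := by
      ext i
      simp only [Set.mem_ofPred_eq, ih, gapSum_succ_round]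
    rw [survivors, hset]
    have hfin : {i : ℕ | 1 ≤ i ∧ gapSum x (n + 1) i ≤ M}.Finite :=
      (Set.finite_Iic M).subset fun i hi => (hmono.id_le i).trans hi.2
    have hcard : ∀ a b : ℕ, (Set.Ico a b).ncard = b - a := fun a b => by
      rw [← Finset.coe_Ico, Set.ncard_coe_finset, Nat.card_Ico]
    constructor
    · intro h
      by_contra hM
      have hj : 0 < j := by
        rcases Nat.eq_zero_or_pos j with rfl | hj
        · simp [gapSum] at hM
        · exact hj
      have hsub : {i : ℕ | 1 ≤ i ∧ gapSum x (n + 1) i ≤ M} ⊆ Set.Ico 1 j := fun i hi =>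
        ⟨hi.1, hmono.lt_iff_lt.1 (hi.2.trans_lt (not_le.1 hM))⟩
      have := Set.ncard_le_ncard hsub (Set.finite_Ico 1 j)
      rw [hcard] at this
      omega
    · intro h
      have hsub : Set.Ico 1 (j + 1) ⊆ {i : ℕ | 1 ≤ i ∧ gapSum x (n + 1) i ≤ M} := fun i hi =>
        ⟨hi.1, (hmono.monotone (Nat.lt_succ_iff.1 hi.2)).trans h⟩
      have := Set.ncard_le_ncard hsub hfin
      rwa [hcard, Nat.add_sub_cancel] at this

include hx in
lemma originalNumber_eq_gapSum (n j : ℕ) :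
    originalNumber x n (j + 1) = gapSum x n (j + 1) := by
  have hmono := strictMono_gapSum hx n
  have hmem : gapSum x n (j + 1) ∈ {i : ℕ | 1 ≤ i ∧ survivors x n i = j + 1} := by
    refine ⟨(Nat.succ_pos j).trans_le (hmono.id_le _), le_antisymm ?_ ?_⟩
    · by_contra h
      have := (le_survivors_iff hx n _ (j + 2)).1 (not_le.1 h)
      exact absurd (hmono.lt_iff_lt.2 (Nat.lt_succ_self (j + 1))) (not_lt.2 this)
    · exact (le_survivors_iff hx n _ (j + 1)).2 le_rfl
  refine le_antisymm (Nat.sInf_le hmem) ?_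
  exact (le_survivors_iff hx n _ _).1 (Nat.sInf_mem ⟨_, hmem⟩).2.ge

/-- The increasing sequence of rescaled logarithms of partial sums of `D`. -/
noncomputable def logSums (b : ℝ) (D : ℕ → ℕ) (j : ℕ) : ℝ :=
  b * Real.log ((∑ i ∈ Finset.range (j + 1), D i : ℕ) : ℝ)

include hx in
lemma logPoints_eq (α : ℝ) (n : ℕ) :
    logPoints α x n = weightedPoints (fun _ => 1) (logSums (α ^ n) (survivorGap x n)) := by
  simp only [logPoints, originalNumber_eq_gapSum hx]
  rfl

lemma measurable_logSums (b : ℝ) (j : ℕ) : Measurable fun D => logSums b D j := by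
  have h : Measurable fun D : ℕ → ℕ => ∑ i ∈ Finset.range (j + 1), D i :=
    Finset.measurable_fun_sum _ fun i _ => measurable_pi_apply i
  exact (measurable_from_top (f := fun k : ℕ => b * Real.log k)).comp h

lemma monotone_logSums {b : ℝ} (hb : 0 ≤ b) {D : ℕ → ℕ} (hD : ∀ i, 0 < D i) :
    Monotone (logSums b D) := by
  intro i j hij
  refine mul_le_mul_of_nonneg_left (Real.log_le_log ?_ ?_) hb
  · exact_mod_cast Finset.sum_pos (fun i _ => hD i) ⟨0, by simp⟩
  · exact_mod_cast Finset.sum_le_sum_of_subset (Finset.range_mono (Nat.succ_le_succ hij))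

lemma tendsto_logSums_atTop {b : ℝ} (hb : 0 < b) {D : ℕ → ℕ} (hD : ∀ i, 0 < D i) :
    Tendsto (logSums b D) atTop atTop := by
  refine Tendsto.const_mul_atTop hb (Real.tendsto_log_atTop.comp
    (tendsto_natCast_atTop_atTop.comp ?_))
  refine tendsto_atTop_mono (fun j => ?_) tendsto_id
  calc j ≤ ∑ i ∈ Finset.range (j + 1), 1 := by simp
    _ ≤ _ := Finset.sum_le_sum fun i _ => hD i

lemma measurable_survivorGap {Y : Type*} {m : MeasurableSpace Y} {x : Y → ℕ → ℕ → ℕ} (n : ℕ)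
    (hx : ∀ k < n, ∀ j, Measurable fun y => x y k j) (i : ℕ) :
    Measurable fun y => survivorGap (x y) n i := by
  induction n generalizing i with
  | zero => exact measurable_const
  | succ n ih =>
    exact measurable_blockSum (hx n (Nat.lt_succ_self n))
      (ih fun k hk => hx k (hk.trans (Nat.lt_succ_self n))) i

end LeaderElection

/-! ### The law of the gaps after $n$ rounds -/

open LeaderElection

lemma comap_pi_le {Y : Type*} {m : MeasurableSpace Y} {f : Y → ℕ → ℕ}
    (hf : ∀ i, Measurable fun y => f y i) : MeasurableSpace.comap f MeasurableSpace.pi ≤ m :=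
  (measurable_pi_iff.2 hf).comap_le

/-- After `n` rounds the gaps are i.i.d. with the Sibuya distribution with parameter `α ^ n`. -/
lemma exists_map_survivorGap {Ω : Type*} [MeasurableSpace Ω] (μ : Measure Ω)
    [IsProbabilityMeasure μ] {α : ℝ} (hα : 0 ≤ α) {ξ : ℕ → ℕ → Ω → ℕ}
    (hξ_law : ∀ n k, IsSibuya α (ξ n k) μ)
    (hξ_indep : iIndepFun (fun q : ℕ × ℕ => ξ q.1 q.2) μ) (n : ℕ) :
    ∃ (ρ : Measure ℕ) (_ : IsProbabilityMeasure ρ), IsSibuyaLaw (α ^ n) ρ ∧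
      μ.map (fun ω => survivorGap (fun m k => ξ m k ω) n) = iidLaw ρ := by
  have hm : ∀ n k, Measurable (ξ n k) := fun n k => (hξ_law n k).1
  have hprob : ∀ n k, IsProbabilityMeasure (μ.map (ξ n k)) := fun n k =>
    Measure.isProbabilityMeasure_map (hm n k).aemeasurable
  have hsib : ∀ n k, IsSibuyaLaw α (μ.map (ξ n k)) := by
    intro n k t ht
    rw [integral_map (hm n k).aemeasurable measurable_from_top.aestronglyMeasurable]
    exact (hξ_law n k).2 t ht
  have hlaw : ∀ n k, μ.map (ξ n k) = μ.map (ξ 0 0) := fun n k =>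
    ext_of_pgf fun t ht => (hsib n k t ht).trans (hsib 0 0 t ht).symm
  have hrow : ∀ n, μ.map (fun ω k => ξ n k ω) = iidLaw (μ.map (ξ 0 0)) := by
    intro n
    have h := hξ_indep.precomp (g := fun k : ℕ => (n, k)) fun a b hab => (Prod.mk.inj hab).2
    have h2 := (iIndepFun_iff_map_fun_eq_infinitePi_map (fun k => hm n k)).1 h
    refine h2.trans ?_
    simp only [hlaw]
    rfl
  have hgapm : ∀ n, Measurable fun ω => survivorGap (fun m k => ξ m k ω) n := fun n =>
    measurable_pi_iff.2 fun i => measurable_survivorGap n (fun k _ j => hm k j) i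
  have hrowm : ∀ n, Measurable fun ω k => ξ n k ω := fun n => measurable_pi_iff.2 fun k => hm n k
  induction n with
  | zero =>
    -- Without any round all gaps are 1, and the point mass at 1 is Sibuya with parameter
    -- $\alpha^0=1$.
    refine ⟨Measure.dirac 1, inferInstance, ?_, ?_⟩
    · intro t _
      simp
    · simp only [survivorGap]
      rw [Measure.map_const, measure_univ, one_smul, iidLaw, Measure.infinitePi_dirac]
  | succ n ih =>
    obtain ⟨ρ, hρ, hs, hmap⟩ := ih
    refine ⟨randomSumLaw ρ (μ.map (ξ 0 0)), inferInstance, ?_, ?_⟩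
    · rw [pow_succ]
      exact hs.randomSumLaw (pow_nonneg hα n) hα (hsib 0 0)
    · have hind : IndepFun (fun ω k => ξ n k ω)
          (fun ω => survivorGap (fun m k => ξ m k ω) n) μ := by
        have hle : ∀ q : ℕ × ℕ, MeasurableSpace.comap (ξ q.1 q.2) inferInstance ≤
            (inferInstance : MeasurableSpace Ω) := fun q => (hm q.1 q.2).comap_le
        -- The gaps after `n` rounds depend only on the rows below `n`, whereas the new block
        -- lengths are row `n`.
        have hdisj : Disjoint {q : ℕ × ℕ | q.1 = n} {q : ℕ × ℕ | q.1 < n} := by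
          rw [Set.disjoint_left]
          intro q h1 h2
          exact absurd h1 (ne_of_lt h2)
        have h := indep_iSup_of_disjoint hle hξ_indep hdisj
        have key : ∀ (S : Set (ℕ × ℕ)) (q : ℕ × ℕ), q ∈ S →
            Measurable[⨆ i ∈ S, MeasurableSpace.comap (ξ i.1 i.2) inferInstance] (ξ q.1 q.2) :=
          fun S q hq => Measurable.mono (comap_measurable (ξ q.1 q.2))
            (le_iSup₂ (f := fun (i : ℕ × ℕ) (_ : i ∈ S) =>
              MeasurableSpace.comap (ξ i.1 i.2) inferInstance) q hq) le_rfl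
        refine indep_of_indep_of_le_left (indep_of_indep_of_le_right h ?_) ?_
        · refine comap_pi_le fun i => ?_
          exact measurable_survivorGap n (fun k hk j => key {q | q.1 < n} (k, j) hk) i
        · exact comap_pi_le fun k => key {q | q.1 = n} (n, k) rfl
      have hpair := (indepFun_iff_map_prod_eq_prod_map_map (hrowm n).aemeasurable
        (hgapm n).aemeasurable).1 hind
      rw [hmap, hrow n] at hpair
      rw [← map_blockSum, ← hpair, Measure.map_map _ ((hrowm n).prodMk (hgapm n))]
      · rfl
      · exact measurable_pi_iff.2 fun j => measurable_blockSum
          (fun i => (measurable_pi_apply i).comp measurable_fst)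
          (fun i => (measurable_pi_apply i).comp measurable_snd) j

/-- Sibuya variables are almost surely positive. -/
lemma ae_pos_of_isSibuya {Ω : Type*} [MeasurableSpace Ω] {μ : Measure Ω}
    [IsProbabilityMeasure μ] {α : ℝ} {ξ : ℕ → ℕ → Ω → ℕ}
    (hξ_law : ∀ n k, IsSibuya α (ξ n k) μ) : ∀ᵐ ω ∂μ, ∀ n k, 0 < ξ n k ω := by
  refine ae_all_iff.2 fun n => ae_all_iff.2 fun k => ?_
  have hm := (hξ_law n k).1
  have := Measure.isProbabilityMeasure_map (μ := μ) hm.aemeasurable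
  have hsib : IsSibuyaLaw α (μ.map (ξ n k)) := by
    intro t ht
    rw [integral_map hm.aemeasurable measurable_from_top.aestronglyMeasurable]
    exact (hξ_law n k).2 t ht
  have h0 := hsib.measure_zero
  rw [Measure.map_apply hm (measurableSet_singleton 0)] at h0
  rw [ae_iff]
  refine le_antisymm ((measure_mono fun ω hω => ?_).trans h0.le) zero_le
  simpa using hω

/-! ### Sequences with repetitions in place of multiplicities -/

/-- The shifted sequence `s 1, s 2, …`. -/
def tailSeq {X : Type*} (s : ℕ → X) (i : ℕ) : X := s (i + 1)

/-- The sequence in which `p 0` appears `k 0 + 1` times, then `p 1` appears `k 1 + 1` times,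
and so on. -/
def repeatSeq (p : ℕ → ℝ) (k : ℕ → ℕ) : ℕ → ℝ
  | 0 => p 0
  | j + 1 => if k 0 = 0 then repeatSeq (tailSeq p) (tailSeq k) j
      else repeatSeq p (consSeq (k 0 - 1) (tailSeq k)) j

lemma repeatSeq_congr {p : ℕ → ℝ} {k k' : ℕ → ℕ} {j : ℕ} (h : ∀ i < j, k i = k' i) :
    repeatSeq p k j = repeatSeq p k' j := by
  induction j generalizing p k k' with
  | zero => rfl
  | succ j ih =>
    rw [repeatSeq, repeatSeq, h 0 (Nat.succ_pos j)]
    split_ifs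
    · exact ih fun i hi => h (i + 1) (Nat.succ_lt_succ hi)
    · refine ih fun i hi => ?_
      cases i with
      | zero => rfl
      | succ i => exact h (i + 1) (hi.trans (Nat.lt_succ_self j))

lemma measurable_repeatSeq {Y : Type*} [MeasurableSpace Y] {p : Y → ℕ → ℝ} {k : Y → ℕ → ℕ}
    (hp : ∀ i, Measurable fun y => p y i) (hk : ∀ i, Measurable fun y => k y i) (j : ℕ) :
    Measurable fun y => repeatSeq (p y) (k y) j := by
  induction j generalizing p k with
  | zero => exact hp 0
  | succ j ih =>
    refine Measurable.ite (measurableSet_eq_fun (hk 0) measurable_const) ?_ ?_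
    · exact ih (fun i => hp (i + 1)) fun i => hk (i + 1)
    · refine ih hp fun i => ?_
      cases i with
      | zero => exact (measurable_from_top (f := fun n : ℕ => n - 1)).comp (hk 0)
      | succ i => exact hk (i + 1)

lemma tsum_succ_eq {f : ℕ → ℝ≥0∞} : ∑' i, f i = f 0 + ∑' i, f (i + 1) :=
  tsum_eq_zero_add' ENNReal.summable

lemma tsum_mul_eq_step (f : ℝ → ℝ≥0∞) (p : ℕ → ℝ) (k : ℕ → ℕ) :
    ∑' i, ((k i + 1 : ℕ) : ℝ≥0∞) * f (p i) = f (p 0) + if k 0 = 0 then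
      ∑' i, ((tailSeq k i + 1 : ℕ) : ℝ≥0∞) * f (tailSeq p i)
      else ∑' i, ((consSeq (k 0 - 1) (tailSeq k) i + 1 : ℕ) : ℝ≥0∞) * f (p i) := by
  rw [tsum_succ_eq]
  split_ifs with h
  · rw [h, zero_add, Nat.cast_one, one_mul]
    rfl
  · obtain ⟨l, hl⟩ := Nat.exists_eq_succ_of_ne_zero h
    conv_rhs => rw [tsum_succ_eq]
    rw [← add_assoc, hl]
    simp only [consSeq, tailSeq, Nat.succ_eq_add_one, Nat.add_sub_cancel]
    congr 1
    push_cast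
    ring

/-- The weighted sum over the points equals the sum over the points with repetitions. -/
lemma tsum_repeatSeq (f : ℝ → ℝ≥0∞) (p : ℕ → ℝ) (k : ℕ → ℕ) :
    ∑' j, f (repeatSeq p k j) = ∑' i, ((k i + 1 : ℕ) : ℝ≥0∞) * f (p i) := by
  apply le_antisymm
  -- Finitely many terms are peeled off one at a time, for which one step of the recursion suffices.
  · rw [ENNReal.tsum_eq_iSup_nat]
    refine iSup_le fun J => ?_
    induction J generalizing p k with
    | zero => simp
    | succ J ih =>
      rw [Finset.sum_range_succ', add_comm, tsum_mul_eq_step]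
      refine add_le_add le_rfl ?_
      simp only [repeatSeq]
      split_ifs
      · exact ih _ _
      · exact ih _ _
  -- In the other direction a term of the weighted sum is a whole block of repetitions, so blocks
  -- are peeled off.
  · have hblock : ∀ (l : ℕ) (p : ℕ → ℝ) (k : ℕ → ℕ), ∑' j, f (repeatSeq p (consSeq l k) j) =
        ((l + 1 : ℕ) : ℝ≥0∞) * f (p 0) + ∑' j, f (repeatSeq (tailSeq p) k j) := by
      intro l p k
      induction l with
      | zero =>
        rw [tsum_succ_eq, zero_add, Nat.cast_one, one_mul]
        rfl
      | succ l ih =>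
        rw [tsum_succ_eq]
        have : ∀ j, repeatSeq p (consSeq (l + 1) k) (j + 1) = repeatSeq p (consSeq l k) j :=
          fun j => by
            rw [repeatSeq, if_neg (show ¬ consSeq (l + 1) k 0 = 0 from Nat.succ_ne_zero l)]
            rfl
        simp_rw [this, ih]
        rw [← add_assoc]
        congr 1
        simp only [repeatSeq]
        push_cast
        ring
    have hk : ∀ k : ℕ → ℕ, consSeq (k 0) (tailSeq k) = k := fun k => by
      funext i
      cases i <;> rfl
    rw [ENNReal.tsum_eq_iSup_nat]
    refine iSup_le fun n => ?_
    induction n generalizing p k with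
    | zero => simp
    | succ n ih =>
      have h := hblock (k 0) p (tailSeq k)
      rw [hk] at h
      rw [h, Finset.sum_range_succ', add_comm]
      exact add_le_add le_rfl (ih (tailSeq p) (tailSeq k))

lemma weightedPoints_repeatSeq (p : ℕ → ℝ) (k : ℕ → ℕ) :
    weightedPoints (fun i => k i + 1) p = weightedPoints (fun _ => 1) (repeatSeq p k) := by
  ext s hs
  rw [weightedPoints_apply _ _ hs, weightedPoints_apply _ _ hs]
  simp only [Nat.cast_one, one_mul]
  exact (tsum_repeatSeq (fun y => s.indicator 1 y.toNNReal) p k).symm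

/-! ### Averaging over geometric multiplicities -/

section Geometric

/-- The geometric weight of `l ∈ {0, 1, …}` with success probability `exp (-y)`. -/
noncomputable def geoWeight (y : ℝ) (l : ℕ) : ℝ≥0∞ :=
  ENNReal.ofReal ((1 - Real.exp (-y)) ^ l * Real.exp (-y))

lemma geoWeight_zero (y : ℝ) : geoWeight y 0 = ENNReal.ofReal (Real.exp (-y)) := by
  simp [geoWeight]

lemma one_sub_exp_neg_nonneg {y : ℝ} (hy : 0 ≤ y) : 0 ≤ 1 - Real.exp (-y) :=
  sub_nonneg.2 (Real.exp_le_one_iff.2 (by linarith))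

lemma geoWeight_succ {y : ℝ} (hy : 0 ≤ y) (l : ℕ) :
    geoWeight y (l + 1) = ENNReal.ofReal (1 - Real.exp (-y)) * geoWeight y l := by
  rw [geoWeight, geoWeight, ← ENNReal.ofReal_mul (one_sub_exp_neg_nonneg hy), pow_succ']
  ring_nf

lemma tsum_geoWeight {y : ℝ} (hy : 0 ≤ y) : ∑' l, geoWeight y l = 1 := by
  have h0 := one_sub_exp_neg_nonneg hy
  have h1 : 1 - Real.exp (-y) < 1 := by linarith [Real.exp_pos (-y)]
  have h2 := (hasSum_geometric_of_lt_one h0 h1).mul_right (Real.exp (-y))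
  simp only [geoWeight]
  rw [← ENNReal.ofReal_tsum_of_nonneg (fun l => mul_nonneg (pow_nonneg h0 l) (Real.exp_pos _).le)
    h2.summable, h2.tsum_eq]
  simp [Real.exp_ne_zero]

lemma measurable_geoWeight (l : ℕ) : Measurable fun y => geoWeight y l := by
  unfold geoWeight
  fun_prop

/-- Extension of a finite sequence by zeros. -/
def extendZero {N : ℕ} (k : Fin N → ℕ) (i : ℕ) : ℕ := if h : i < N then k ⟨i, h⟩ else 0

lemma extendZero_cons {N : ℕ} (l : ℕ) (k : Fin N → ℕ) :
    extendZero (Fin.cons l k : Fin (N + 1) → ℕ) = consSeq l (extendZero k) := by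
  funext i
  cases i with
  | zero => rfl
  | succ i =>
    simp only [extendZero, consSeq, Nat.add_lt_add_iff_right]
    split_ifs with h
    · exact Fin.cons_succ (α := fun _ => ℕ) l k ⟨i, h⟩
    · rfl

/-- The product of the geometric weights of `k 0, …, k (N - 1)`. -/
noncomputable def geoProd (N : ℕ) (p : ℕ → ℝ) (k : ℕ → ℕ) : ℝ≥0∞ :=
  ∏ i ∈ Finset.range N, geoWeight (p i) (k i)

lemma geoProd_cons (N : ℕ) (p : ℕ → ℝ) (l : ℕ) (k : ℕ → ℕ) :
    geoProd (N + 1) p (consSeq l k) = geoWeight (p 0) l * geoProd N (tailSeq p) k := by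
  rw [geoProd, Finset.prod_range_succ', mul_comm]
  rfl

/-- The mean of `Φ` over independent geometric variables, of which only the first `N` are random. -/
noncomputable def geoMean (N : ℕ) (p : ℕ → ℝ) (Φ : (ℕ → ℕ) → ℝ≥0∞) : ℝ≥0∞ :=
  ∑' k : Fin N → ℕ, geoProd N p (extendZero k) * Φ (extendZero k)

lemma geoMean_succ (N : ℕ) (p : ℕ → ℝ) (Φ : (ℕ → ℕ) → ℝ≥0∞) :
    geoMean (N + 1) p Φ =
      ∑' l, geoWeight (p 0) l * geoMean N (tailSeq p) fun k => Φ (consSeq l k) := by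
  have hsum : ∀ f : (Fin (N + 1) → ℕ) → ℝ≥0∞,
      ∑' k, f k = ∑' (l : ℕ) (k : Fin N → ℕ), f (Fin.cons l k) := fun f => by
    rw [← (Fin.consEquiv fun _ => ℕ).tsum_eq f]
    exact ENNReal.tsum_prod (f := fun l (k : Fin N → ℕ) => f (Fin.cons l k))
  rw [geoMean, hsum]
  refine tsum_congr fun l => ?_
  rw [geoMean, ← ENNReal.tsum_mul_left]
  refine tsum_congr fun k => ?_
  rw [← mul_assoc, ← geoProd_cons, ← extendZero_cons]

lemma geoMean_one (N : ℕ) {p : ℕ → ℝ} (hp : ∀ i, 0 ≤ p i) : geoMean N p (fun _ => 1) = 1 := by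
  induction N generalizing p with
  | zero => simp [geoMean, geoProd]
  | succ N ih =>
    rw [geoMean_succ, ih (p := tailSeq p) fun i => hp (i + 1)]
    simp [tsum_geoWeight (hp 0)]

lemma geoMean_const_mul (N : ℕ) (p : ℕ → ℝ) (c : ℝ≥0∞) (Φ : (ℕ → ℕ) → ℝ≥0∞) :
    geoMean N p (fun k => c * Φ k) = c * geoMean N p Φ := by
  rw [geoMean, geoMean, ← ENNReal.tsum_mul_left]
  exact tsum_congr fun k => mul_left_comm _ _ _

/-- The product of test functions along the sequence with repetitions. -/
noncomputable def repeatProd (m : ℕ) (h : ℕ → ℝ → ℝ≥0∞) (p : ℕ → ℝ) (k : ℕ → ℕ) : ℝ≥0∞ :=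
  ∏ j ∈ Finset.range m, h j (repeatSeq p k j)

lemma repeatProd_succ (m : ℕ) (h : ℕ → ℝ → ℝ≥0∞) (p : ℕ → ℝ) (k : ℕ → ℕ) :
    repeatProd (m + 1) h p k = h 0 (p 0) * if k 0 = 0 then
      repeatProd m (tailSeq h) (tailSeq p) (tailSeq k)
      else repeatProd m (tailSeq h) p (consSeq (k 0 - 1) (tailSeq k)) := by
  rw [repeatProd, Finset.prod_range_succ', mul_comm]
  congr 1
  split_ifs with hk
  · exact Finset.prod_congr rfl fun j _ => by rw [repeatSeq, if_pos hk]; rfl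
  · exact Finset.prod_congr rfl fun j _ => by rw [repeatSeq, if_neg hk]; rfl

lemma measurable_repeatProd {Y : Type*} [MeasurableSpace Y] (m : ℕ) {h : ℕ → ℝ → ℝ≥0∞}
    (hh : ∀ j, Measurable (h j)) {p : Y → ℕ → ℝ} {k : Y → ℕ → ℕ}
    (hp : ∀ i, Measurable fun y => p y i) (hk : ∀ i, Measurable fun y => k y i) :
    Measurable fun y => repeatProd m h (p y) (k y) :=
  Finset.measurable_fun_prod _ fun j _ => (hh j).comp (measurable_repeatSeq hp hk j)

/-- The mean of `repeatProd` over independent geometric repetition numbers, in recursive form. -/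
noncomputable def repeatMean : ℕ → (ℕ → ℝ → ℝ≥0∞) → (ℕ → ℝ) → ℝ≥0∞
  | 0, _, _ => 1
  | m + 1, h, p => h 0 (p 0) *
      (ENNReal.ofReal (Real.exp (-p 0)) * repeatMean m (tailSeq h) (tailSeq p) +
        ENNReal.ofReal (1 - Real.exp (-p 0)) * repeatMean m (tailSeq h) p)

/-- Geometric variables are memoryless: given that the first point is repeated, the number of its
further repetitions is geometric with the same parameter. A repetition leaves `p` unshifted, so `m`
drops while `N` does not; this is why all `N ≥ m` are treated together. -/
lemma geoMean_repeatProd {m N : ℕ} (hmN : m ≤ N) (h : ℕ → ℝ → ℝ≥0∞) {p : ℕ → ℝ}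
    (hp : ∀ i, 0 ≤ p i) : geoMean N p (repeatProd m h p) = repeatMean m h p := by
  induction m generalizing N h p with
  | zero =>
    exact geoMean_one N hp
  | succ m ih =>
    obtain ⟨N, rfl⟩ : ∃ N', N = N' + 1 := ⟨N - 1, by omega⟩
    have h0 : ∀ k : ℕ → ℕ, repeatProd (m + 1) h p (consSeq 0 k) =
        h 0 (p 0) * repeatProd m (tailSeq h) (tailSeq p) k := fun k => by
      rw [repeatProd_succ, if_pos (show consSeq 0 k 0 = 0 from rfl)]
      rfl
    have h1 : ∀ l (k : ℕ → ℕ), repeatProd (m + 1) h p (consSeq (l + 1) k) =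
        h 0 (p 0) * repeatProd m (tailSeq h) p (consSeq l k) := fun l k => by
      rw [repeatProd_succ, if_neg (show ¬ consSeq (l + 1) k 0 = 0 from Nat.succ_ne_zero l)]
      rfl
    rw [geoMean_succ, tsum_succ_eq]
    simp_rw [h0, h1, geoMean_const_mul, geoWeight_succ (hp 0)]
    rw [ih (Nat.le_of_succ_le_succ hmN) _ (p := tailSeq p) fun i => hp (i + 1),
      geoWeight_zero, repeatMean, mul_add]
    congr 1
    · exact mul_left_comm _ _ _
    · rw [← ih (Nat.le_of_succ_le hmN) _ hp, geoMean_succ, ← ENNReal.tsum_mul_left,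
        ← ENNReal.tsum_mul_left]
      refine tsum_congr fun l => ?_
      ring

lemma measurable_repeatMean {Y : Type*} [MeasurableSpace Y] (m : ℕ) {h : ℕ → ℝ → ℝ≥0∞}
    (hh : ∀ j, Measurable (h j)) {p : Y → ℕ → ℝ} (hp : ∀ i, Measurable fun y => p y i) :
    Measurable fun y => repeatMean m h (p y) := by
  induction m generalizing h p with
  | zero => exact measurable_const
  | succ m ih =>
    have e : Measurable fun y => Real.exp (-p y 0) := Real.measurable_exp.comp (hp 0).neg
    refine ((hh 0).comp (hp 0)).mul (Measurable.add ?_ ?_)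
    · exact e.ennreal_ofReal.mul (ih (fun j => hh (j + 1)) fun i => hp (i + 1))
    · exact (e.const_sub 1).ennreal_ofReal.mul (ih (fun j => hh (j + 1)) hp)

end Geometric

/-! ### Conditionally geometric variables given the points -/

section CondGeometric

variable {Ω' : Type*} [MeasurableSpace Ω'] {μ' : Measure Ω'} [IsProbabilityMeasure μ']
  {P : ℕ → Ω' → ℝ} {G : ℕ → Ω' → ℕ}

lemma measure_inter_of_condGeometric (hPm : ∀ i, Measurable (P i))
    (hP0 : ∀ᵐ ω ∂μ', ∀ i, 0 ≤ P i ω) (hG : IsCondGeometric G P μ') (N : ℕ) (k : ℕ → ℕ)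
    {B : Set (ℕ → ℝ)} (hB : MeasurableSet B) :
    μ' ({ω | ∀ i < N, G i ω = k i + 1} ∩ (fun ω i => P i ω) ⁻¹' B) =
      ∫⁻ ω in (fun ω i => P i ω) ⁻¹' B, geoProd N (fun i => P i ω) k ∂μ' := by
  have hPm' : Measurable fun ω i => P i ω := measurable_pi_iff.2 hPm
  have hE : MeasurableSet {ω | ∀ i < N, G i ω = k i + 1} := by
    simp_rw [Set.ofPred_forall]
    exact MeasurableSet.iInter fun i => MeasurableSet.iInter fun _ =>
      hG.measurable i (measurableSet_singleton _)
  have hint : Integrable (Set.indicator {ω | ∀ i < N, G i ω = k i + 1} fun _ => (1 : ℝ)) μ' :=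
    (integrable_const _).indicator hE
  have h1 := setIntegral_condExp hPm'.comap_le hint ⟨B, hB, rfl⟩
  have hcond := hG.condProb N k
  rw [setIntegral_congr_ae (hPm' hB) (hcond.mono fun ω hω _ => hω),
    setIntegral_indicator hE, setIntegral_one_eq_measureReal] at h1
  have hprod : Integrable (fun ω => ∏ i ∈ Finset.range N,
      (1 - Real.exp (-P i ω)) ^ k i * Real.exp (-P i ω)) μ' := integrable_condExp.congr hcond
  have hnn : ∀ᵐ ω ∂μ', ∀ i, 0 ≤ (1 - Real.exp (-P i ω)) ^ k i * Real.exp (-P i ω) := by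
    filter_upwards [hP0] with ω hω i
    exact mul_nonneg (pow_nonneg (one_sub_exp_neg_nonneg (hω i)) _) (Real.exp_pos _).le
  rw [Set.inter_comm, ← ofReal_measureReal, ← h1,
    ofReal_integral_eq_lintegral_ofReal hprod.integrableOn]
  · refine lintegral_congr_ae (ae_restrict_of_ae ?_)
    filter_upwards [hnn] with ω hω
    exact ENNReal.ofReal_prod_of_nonneg fun i _ => hω i
  · refine ae_restrict_of_ae ?_
    filter_upwards [hnn] with ω hω
    exact Finset.prod_nonneg fun i _ => hω i

lemma measurable_geoProd (hPm : ∀ i, Measurable (P i)) (N : ℕ) (k : ℕ → ℕ) :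
    Measurable fun ω => geoProd N (fun i => P i ω) k :=
  Finset.measurable_fun_prod _ fun i _ => (measurable_geoWeight (k i)).comp (hPm i)

/-- On sets of point sequences this is the definition of conditional probability. It says that two
measures on sequences coincide, hence so do their integrals of any nonnegative measurable function.
-/
lemma setLIntegral_of_condGeometric (hPm : ∀ i, Measurable (P i))
    (hP0 : ∀ᵐ ω ∂μ', ∀ i, 0 ≤ P i ω) (hG : IsCondGeometric G P μ') (N : ℕ) (k : ℕ → ℕ)
    {F : (ℕ → ℝ) → ℝ≥0∞} (hF : Measurable F) :
    ∫⁻ ω in {ω | ∀ i < N, G i ω = k i + 1}, F (fun i => P i ω) ∂μ' =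
      ∫⁻ ω, geoProd N (fun i => P i ω) k * F (fun i => P i ω) ∂μ' := by
  have hPm' : Measurable fun ω i => P i ω := measurable_pi_iff.2 hPm
  have hg := measurable_geoProd hPm N k
  have hmeas : (μ'.restrict {ω | ∀ i < N, G i ω = k i + 1}).map (fun ω i => P i ω) =
      (μ'.withDensity fun ω => geoProd N (fun i => P i ω) k).map fun ω i => P i ω := by
    ext B hB
    rw [Measure.map_apply hPm' hB, Measure.map_apply hPm' hB,
      Measure.restrict_apply (hPm' hB), withDensity_apply _ (hPm' hB), Set.inter_comm]
    exact measure_inter_of_condGeometric hPm hP0 hG N k hB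
  have h := congrArg (fun m => ∫⁻ p, F p ∂m) hmeas
  rw [lintegral_map hF hPm', lintegral_map hF hPm',
    lintegral_withDensity_eq_lintegral_mul _ hg (g := fun ω => F fun i => P i ω)
      (hF.comp hPm')] at h
  exact h

lemma exists_fin_iff (N : ℕ) (g : ℕ → ℕ) (k : Fin N → ℕ) :
    (∀ i < N, g i = extendZero k i + 1) ↔ ∀ i : Fin N, g i = k i + 1 := by
  constructor
  · intro h i
    have := h i i.2
    rwa [extendZero, dif_pos i.2] at this
  · intro h i hi
    rw [extendZero, dif_pos hi]
    exact h ⟨i, hi⟩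

/-- The prescribed probabilities concern positive values only; as they sum to 1, nothing is left for
the value 0. -/
lemma ae_pos_of_condGeometric (hPm : ∀ i, Measurable (P i))
    (hP0 : ∀ᵐ ω ∂μ', ∀ i, 0 ≤ P i ω) (hG : IsCondGeometric G P μ') :
    ∀ᵐ ω ∂μ', ∀ i, 0 < G i ω := by
  refine ae_all_iff.2 fun n => ?_
  have hE : ∀ k : Fin (n + 1) → ℕ,
      MeasurableSet {ω | ∀ i < n + 1, G i ω = extendZero k i + 1} := fun k => by
    simp_rw [Set.ofPred_forall]
    exact MeasurableSet.iInter fun i => MeasurableSet.iInter fun _ =>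
      hG.measurable i (measurableSet_singleton _)
  have hunion : μ' (⋃ k : Fin (n + 1) → ℕ, {ω | ∀ i < n + 1, G i ω = extendZero k i + 1}) = 1 := by
    rw [measure_iUnion _ hE]
    · have h := fun k : Fin (n + 1) → ℕ =>
        measure_inter_of_condGeometric hPm hP0 hG (n + 1) (extendZero k) MeasurableSet.univ
      simp only [Set.preimage_univ, Set.inter_univ, Measure.restrict_univ] at h
      simp_rw [h]
      rw [← lintegral_tsum fun k => (measurable_geoProd hPm _ _).aemeasurable]
      calc _ = ∫⁻ _, 1 ∂μ' := by
            refine lintegral_congr_ae ?_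
            filter_upwards [hP0] with ω hω
            simpa [geoMean] using geoMean_one (n + 1) hω
        _ = 1 := by simp
    · intro k k' hkk'
      rw [Function.onFun, Set.disjoint_left]
      intro ω h1 h2
      refine hkk' (funext fun i => ?_)
      have a := (exists_fin_iff _ (fun i => G i ω) k).1 h1 i
      have b := (exists_fin_iff _ (fun i => G i ω) k').1 h2 i
      omega
  have hae : ∀ᵐ ω ∂μ', ω ∈ ⋃ k : Fin (n + 1) → ℕ, {ω | ∀ i < n + 1, G i ω = extendZero k i + 1} :=
    (mem_ae_iff_prob_eq_one (MeasurableSet.iUnion hE)).2 hunion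
  filter_upwards [hae] with ω hω
  obtain ⟨k, hk⟩ := Set.mem_iUnion.1 hω
  rw [hk n (Nat.lt_succ_self n)]
  exact Nat.succ_pos _

lemma lintegral_repeatProd (hPm : ∀ i, Measurable (P i))
    (hP0 : ∀ᵐ ω ∂μ', ∀ i, 0 ≤ P i ω) (hG : IsCondGeometric G P μ') (m : ℕ)
    {h : ℕ → ℝ → ℝ≥0∞} (hh : ∀ j, Measurable (h j)) :
    ∫⁻ ω, repeatProd m h (fun i => P i ω) (fun i => G i ω - 1) ∂μ' =
      ∫⁻ ω, repeatMean m h (fun i => P i ω) ∂μ' := by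
  classical
  have hE : ∀ k : Fin m → ℕ, MeasurableSet {ω | ∀ i < m, G i ω = extendZero k i + 1} := fun k => by
    simp_rw [Set.ofPred_forall]
    exact MeasurableSet.iInter fun i => MeasurableSet.iInter fun _ =>
      hG.measurable i (measurableSet_singleton _)
  have hF : ∀ k : ℕ → ℕ, Measurable fun p : ℕ → ℝ => repeatProd m h p k := fun k =>
    measurable_repeatProd m hh (fun i => measurable_pi_apply i) fun _ => measurable_const
  have hPm' : Measurable fun ω i => P i ω := measurable_pi_iff.2 hPm
  calc ∫⁻ ω, repeatProd m h (fun i => P i ω) (fun i => G i ω - 1) ∂μ'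
      = ∫⁻ ω, ∑' k : Fin m → ℕ, {ω | ∀ i < m, G i ω = extendZero k i + 1}.indicator
          (fun ω => repeatProd m h (fun i => P i ω) (extendZero k)) ω ∂μ' := by
        refine lintegral_congr_ae ?_
        filter_upwards [ae_pos_of_condGeometric hPm hP0 hG] with ω hω
        -- The events partition the space up to a null set, and the first `m` entries with
        -- repetitions involve at most the first `m` multiplicities.
        rw [tsum_eq_single fun i : Fin m => G i ω - 1]
        · rw [Set.indicator_of_mem]
          · refine Finset.prod_congr rfl fun j hj => ?_
            rw [repeatSeq_congr fun i hi => ?_]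
            rw [extendZero, dif_pos (hi.trans (Finset.mem_range.1 hj))]
          · refine (exists_fin_iff _ (fun i => G i ω) _).2 fun i => ?_
            have := hω i
            omega
        · intro k hk
          refine Set.indicator_of_notMem (fun hmem => hk (funext fun i => ?_)) _
          have := (exists_fin_iff _ (fun i => G i ω) k).1 hmem i
          omega
    _ = ∑' k : Fin m → ℕ, ∫⁻ ω, geoProd m (fun i => P i ω) (extendZero k) *
          repeatProd m h (fun i => P i ω) (extendZero k) ∂μ' := by
        have hmk : ∀ k : Fin m → ℕ, Measurable fun ω =>
            {ω | ∀ i < m, G i ω = extendZero k i + 1}.indicator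
              (fun ω => repeatProd m h (fun i => P i ω) (extendZero k)) ω := fun k =>
          ((hF (extendZero k)).comp hPm').indicator (hE k)
        rw [lintegral_tsum fun k => (hmk k).aemeasurable]
        refine tsum_congr fun k => ?_
        rw [lintegral_indicator (hE k)]
        exact setLIntegral_of_condGeometric hPm hP0 hG m (extendZero k) (hF (extendZero k))
    _ = ∫⁻ ω, repeatMean m h (fun i => P i ω) ∂μ' := by
        have hmk : ∀ k : Fin m → ℕ, Measurable fun ω => geoProd m (fun i => P i ω) (extendZero k) *
            repeatProd m h (fun i => P i ω) (extendZero k) := fun k =>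
          (measurable_geoProd hPm _ _).mul ((hF (extendZero k)).comp hPm')
        rw [← lintegral_tsum fun k => (hmk k).aemeasurable]
        refine lintegral_congr_ae ?_
        filter_upwards [hP0] with ω hω
        exact geoMean_repeatProd le_rfl h hω

end CondGeometric

/-! ### The running maximum of exponential variables -/

lemma expMeasure_Iic_of_nonpos {x : ℝ} (hx : x ≤ 0) : expMeasure 1 (Set.Iic x) = 0 :=
  measure_mono_null (Set.Iic_subset_Iic.2 hx) expMeasure_Iic_zero

lemma ae_expMeasure_pos : ∀ᵐ x ∂(expMeasure 1), 0 < x := by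
  rw [ae_iff]
  simpa only [not_lt] using! expMeasure_Iic_zero

/-- The memorylessness of the exponential distribution. -/
lemma map_max_expMeasure {x : ℝ} (hx : 0 ≤ x) :
    (expMeasure 1).map (fun y => max x y) = ENNReal.ofReal (1 - Real.exp (-x)) • Measure.dirac x +
      ENNReal.ofReal (Real.exp (-x)) • (expMeasure 1).map (fun y => x + y) := by
  have hm : Measurable fun y : ℝ => max x y := measurable_const.max measurable_id
  have ha : Measurable fun y : ℝ => x + y := measurable_const_add x
  have := Measure.isProbabilityMeasure_map (μ := expMeasure 1) hm.aemeasurable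
  refine Measure.ext_of_Iic _ _ fun a => ?_
  have h1 : (fun y : ℝ => x + y) ⁻¹' Set.Iic a = Set.Iic (a - x) := by
    ext y
    simp only [Set.mem_preimage, Set.mem_Iic]
    constructor <;> intro h <;> linarith
  rw [Measure.add_apply, Measure.smul_apply, Measure.smul_apply, smul_eq_mul, smul_eq_mul,
    Measure.map_apply hm measurableSet_Iic, Measure.map_apply ha measurableSet_Iic,
    Measure.dirac_apply' _ measurableSet_Iic, h1]
  rcases le_or_gt x a with h | h
  · have h2 : (fun y : ℝ => max x y) ⁻¹' Set.Iic a = Set.Iic a := by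
      ext y
      simp [h]
    rw [h2, expMeasure_Iic (hx.trans h), expMeasure_Iic (sub_nonneg.2 h),
      Set.indicator_of_mem (Set.mem_Iic.2 h), Pi.one_apply, mul_one,
      ← ENNReal.ofReal_mul (Real.exp_pos _).le, ← ENNReal.ofReal_add (one_sub_exp_neg_nonneg hx)]
    · congr 1
      rw [mul_sub, ← Real.exp_add]
      ring_nf
    · exact mul_nonneg (Real.exp_pos _).le (one_sub_exp_neg_nonneg (sub_nonneg.2 h))
  · have h2 : (fun y : ℝ => max x y) ⁻¹' Set.Iic a = ∅ := by
      ext y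
      simp [h]
    rw [h2, expMeasure_Iic_of_nonpos (sub_nonpos.2 h.le), Set.indicator_of_notMem (by simpa using h)]
    simp

lemma lintegral_max_expMeasure {x : ℝ} (hx : 0 ≤ x) {f : ℝ → ℝ≥0∞} (hf : Measurable f) :
    ∫⁻ y, f (max x y) ∂(expMeasure 1) = ENNReal.ofReal (1 - Real.exp (-x)) * f x +
      ENNReal.ofReal (Real.exp (-x)) * ∫⁻ y, f (x + y) ∂(expMeasure 1) := by
  have hm : Measurable fun y : ℝ => max x y := measurable_const.max measurable_id
  rw [← lintegral_map hf hm, map_max_expMeasure hx,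
    lintegral_add_measure, lintegral_smul_measure, lintegral_smul_measure,
    lintegral_dirac' _ hf, lintegral_map hf (measurable_const_add x)]
  rfl

/-- The partial sums of `e`, started from `x`. -/
def sumWalk (x : ℝ) (e : ℕ → ℝ) (i : ℕ) : ℝ := x + ∑ j ∈ Finset.range i, e j

lemma tailSeq_sumWalk (x y : ℝ) (e : ℕ → ℝ) :
    tailSeq (sumWalk x (consSeq y e)) = sumWalk (x + y) e := by
  funext i
  simp only [tailSeq, sumWalk, Finset.sum_range_succ', consSeq]
  ring

lemma measurable_sumWalk {Y : Type*} [MeasurableSpace Y] {x : Y → ℝ} {e : Y → ℕ → ℝ}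
    (hx : Measurable x) (he : ∀ i, Measurable fun y => e y i) (i : ℕ) :
    Measurable fun y => sumWalk (x y) (e y) i :=
  hx.add (Finset.measurable_fun_sum _ fun j _ => he j)

lemma measurable_maxWalk {Y : Type*} [MeasurableSpace Y] {x : Y → ℝ} {e : Y → ℕ → ℝ}
    (hx : Measurable x) (he : ∀ i, Measurable fun y => e y i) (j : ℕ) :
    Measurable fun y => maxWalk (x y) (e y) j := by
  induction j with
  | zero => exact hx
  | succ j ih => exact ih.max (he j)

/-- The mean of a product of test functions along the running maximum. -/
noncomputable def maxMean (m : ℕ) (h : ℕ → ℝ → ℝ≥0∞) (x : ℝ) : ℝ≥0∞ :=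
  ∫⁻ e, ∏ j ∈ Finset.range m, h j (maxWalk x e j) ∂(iidLaw (expMeasure 1))

lemma measurable_prod_maxWalk (m : ℕ) {h : ℕ → ℝ → ℝ≥0∞} (hh : ∀ j, Measurable (h j)) :
    Measurable fun q : ℝ × (ℕ → ℝ) => ∏ j ∈ Finset.range m, h j (maxWalk q.1 q.2 j) :=
  Finset.measurable_fun_prod _ fun j _ => (hh j).comp (measurable_maxWalk measurable_fst
    (fun i => (measurable_pi_apply i).comp measurable_snd) j)

lemma measurable_maxMean (m : ℕ) {h : ℕ → ℝ → ℝ≥0∞} (hh : ∀ j, Measurable (h j)) :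
    Measurable (maxMean m h) :=
  (measurable_prod_maxWalk m hh).lintegral_prod_right'

lemma maxMean_succ (m : ℕ) {h : ℕ → ℝ → ℝ≥0∞} (hh : ∀ j, Measurable (h j)) (x : ℝ) :
    maxMean (m + 1) h x = h 0 x * ∫⁻ y, maxMean m (tailSeq h) (max x y) ∂(expMeasure 1) := by
  have hm : Measurable fun e : ℕ → ℝ => ∏ j ∈ Finset.range (m + 1), h j (maxWalk x e j) :=
    (measurable_prod_maxWalk (m + 1) hh).comp measurable_prodMk_left
  have hstep : ∀ (y : ℝ) (e : ℕ → ℝ),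
      ∏ j ∈ Finset.range (m + 1), h j (maxWalk x (consSeq y e) j) =
        h 0 x * ∏ j ∈ Finset.range m, tailSeq h j (maxWalk (max x y) e j) := by
    intro y e
    rw [Finset.prod_range_succ', mul_comm]
    simp only [maxWalk_succ']
    rfl
  rw [maxMean, lintegral_iidLaw _ hm]
  simp_rw [hstep]
  have hin : ∀ y, Measurable fun e : ℕ → ℝ =>
      ∏ j ∈ Finset.range m, tailSeq h j (maxWalk (max x y) e j) := fun y =>
    (measurable_prod_maxWalk m fun j => hh (j + 1)).comp measurable_prodMk_left
  simp_rw [lintegral_const_mul _ (hin _)]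
  exact lintegral_const_mul _
    ((measurable_maxMean m fun j => hh (j + 1)).comp (measurable_const.max measurable_id))

lemma measurable_repeatMean_sumWalk (m : ℕ) {h : ℕ → ℝ → ℝ≥0∞} (hh : ∀ j, Measurable (h j))
    (x : ℝ) : Measurable fun e : ℕ → ℝ => repeatMean m h (sumWalk x e) :=
  measurable_repeatMean m hh (measurable_sumWalk measurable_const measurable_pi_apply)

/-- First step analysis: the repeated points of a Poisson process and the running maximum of
exponential variables have the same finite-dimensional distributions. -/
lemma maxMean_eq_repeatMean (m : ℕ) {h : ℕ → ℝ → ℝ≥0∞} (hh : ∀ j, Measurable (h j)) {x : ℝ}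
    (hx : 0 ≤ x) :
    maxMean m h x = ∫⁻ e, repeatMean m h (sumWalk x e) ∂(iidLaw (expMeasure 1)) := by
  induction m generalizing h x with
  | zero => simp [maxMean, repeatMean]
  | succ m ih =>
    have hh' : ∀ j, Measurable (tailSeq h j) := fun j => hh (j + 1)
    have hm1 := measurable_repeatMean_sumWalk m hh' x
    have hm2 : Measurable fun e : ℕ → ℝ => repeatMean m (tailSeq h) (tailSeq (sumWalk x e)) :=
      measurable_repeatMean m hh' fun i =>
        measurable_sumWalk measurable_const measurable_pi_apply (i + 1)
    have h0 : ∀ e : ℕ → ℝ, sumWalk x e 0 = x := fun e => by simp [sumWalk]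
    -- Either the maximum stays at `x`, matching a repetition of the current point, or it moves to
    -- `x + y` with `y` exponential, matching the passage to the next Poisson point.
    rw [maxMean_succ m hh, lintegral_max_expMeasure hx (measurable_maxMean m hh'), ih hh' hx]
    simp only [repeatMean, h0]
    have hm3 : Measurable fun e : ℕ → ℝ =>
        ENNReal.ofReal (Real.exp (-x)) * repeatMean m (tailSeq h) (tailSeq (sumWalk x e)) +
          ENNReal.ofReal (1 - Real.exp (-x)) * repeatMean m (tailSeq h) (sumWalk x e) :=
      (hm2.const_mul _).add (hm1.const_mul _)
    rw [lintegral_const_mul _ hm3,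
      lintegral_add_left (hm2.const_mul _), lintegral_const_mul _ hm1, lintegral_const_mul _ hm2,
      lintegral_iidLaw _ hm2, add_comm]
    simp_rw [tailSeq_sumWalk]
    congr 3
    refine lintegral_congr_ae ?_
    filter_upwards [ae_expMeasure_pos] with y hy
    exact ih hh' (by positivity)

lemma prod_indicator_eq (N : ℕ) (t : ℕ → Set ℝ) (e : ℕ → ℝ) :
    ∏ i ∈ Finset.range N, (t i).indicator (1 : ℝ → ℝ≥0∞) (e i) =
      {e : ℕ → ℝ | ∀ i < N, e i ∈ t i}.indicator 1 e := by
  by_cases h : ∀ i < N, e i ∈ t i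
  · rw [Set.indicator_of_mem (s := {e : ℕ → ℝ | ∀ i < N, e i ∈ t i}) h]
    exact Finset.prod_eq_one fun i hi => Set.indicator_of_mem (h i (Finset.mem_range.1 hi)) _
  · rw [Set.indicator_of_notMem (s := {e : ℕ → ℝ | ∀ i < N, e i ∈ t i}) h]
    push Not at h
    obtain ⟨i, hi, hit⟩ := h
    exact Finset.prod_eq_zero (Finset.mem_range.2 hi) (Set.indicator_of_notMem hit _)

lemma measurableSet_box (N : ℕ) {t : ℕ → Set ℝ} (ht : ∀ i, MeasurableSet (t i)) :
    MeasurableSet {e : ℕ → ℝ | ∀ i < N, e i ∈ t i} := by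
  simp_rw [Set.ofPred_forall]
  exact MeasurableSet.iInter fun i => MeasurableSet.iInter fun _ => measurable_pi_apply i (ht i)

/-! ### Poisson points with geometric multiplicities as a running maximum -/

section Poisson

lemma sumWalk_spacing {Ω' : Type*} (P : ℕ → Ω' → ℝ) (ω : Ω') :
    sumWalk (spacing P 0 ω) (tailSeq fun i => spacing P i ω) = fun i => P i ω := by
  funext i
  induction i with
  | zero => simp [sumWalk, spacing]
  | succ i ih =>
    rw [sumWalk] at ih ⊢
    rw [Finset.sum_range_succ, ← add_assoc, ih]
    simp [tailSeq, spacing]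

variable {Ω' : Type*} [MeasurableSpace Ω'] {μ' : Measure Ω'}
  {P : ℕ → Ω' → ℝ} {G : ℕ → Ω' → ℕ}

lemma measurable_spacing (hP : IsStandardPoissonPoints P μ') (i : ℕ) :
    Measurable (spacing P i) := by
  cases i with
  | zero => exact hP.measurable 0
  | succ i => exact (hP.measurable (i + 1)).sub (hP.measurable i)

lemma measurable_repeatSeq_points (hP : IsStandardPoissonPoints P μ')
    (hG : IsCondGeometric G P μ') :
    Measurable fun ω => repeatSeq (fun i => P i ω) (fun i => G i ω - 1) :=
  measurable_pi_iff.2 fun j => measurable_repeatSeq hP.measurable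
    (fun i => (measurable_from_top (f := fun n : ℕ => n - 1)).comp (hG.measurable i)) j

lemma ae_points_nonneg (hP : IsStandardPoissonPoints P μ') : ∀ᵐ ω ∂μ', ∀ i, 0 ≤ P i ω := by
  have h : ∀ᵐ ω ∂μ', ∀ i, 0 < spacing P i ω := ae_all_iff.2 fun i =>
    ae_of_ae_map (measurable_spacing hP i).aemeasurable (by rw [hP.law]; exact ae_expMeasure_pos)
  filter_upwards [h] with ω hω i
  rw [← congrFun (sumWalk_spacing P ω) i]
  exact add_nonneg (hω 0).le (Finset.sum_nonneg fun j _ => (hω (j + 1)).le)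

lemma measurable_runningMax :
    Measurable fun e : ℕ → ℝ => maxWalk (e 0) (tailSeq e) :=
  measurable_pi_iff.2 fun j => measurable_maxWalk (measurable_pi_apply 0)
    (fun i => measurable_pi_apply (i + 1)) j

variable [IsProbabilityMeasure μ']

lemma map_spacing (hP : IsStandardPoissonPoints P μ') :
    μ'.map (fun ω i => spacing P i ω) = iidLaw (expMeasure 1) := by
  refine ((iIndepFun_iff_map_fun_eq_infinitePi_map (measurable_spacing hP)).1 hP.indep).trans ?_
  simp only [hP.law]
  rfl

/-- The Poisson points, repeated according to their geometric multiplicities, have the law of the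
running maximum of i.i.d. exponential variables. -/
lemma map_repeatSeq_points (hP : IsStandardPoissonPoints P μ') (hG : IsCondGeometric G P μ') :
    μ'.map (fun ω => repeatSeq (fun i => P i ω) (fun i => G i ω - 1)) =
      (iidLaw (expMeasure 1)).map fun e => maxWalk (e 0) (tailSeq e) := by
  have hQ := measurable_repeatSeq_points hP hG
  have := Measure.isProbabilityMeasure_map (μ := μ') hQ.aemeasurable
  refine ext_of_boxes fun N t ht => ?_
  have hbox := measurableSet_box N ht
  -- The probability of a box is the mean of a product of indicators, one for each coordinate, to
  -- which the recursions apply.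
  set h : ℕ → ℝ → ℝ≥0∞ := fun j => (t j).indicator 1 with hh
  have hhm : ∀ j, Measurable (h j) := fun j => measurable_one.indicator (ht j)
  have hind : Measurable ({e : ℕ → ℝ | ∀ i < N, e i ∈ t i}.indicator (1 : (ℕ → ℝ) → ℝ≥0∞)) :=
    measurable_one.indicator hbox
  rw [← lintegral_indicator_one hbox, ← lintegral_indicator_one hbox, lintegral_map hind hQ,
    lintegral_map hind measurable_runningMax]
  simp_rw [← prod_indicator_eq]
  have hL := lintegral_repeatProd hP.measurable (ae_points_nonneg hP) hG N hhm
  refine hL.trans ?_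
  have hsp : Measurable fun ω i => spacing P i ω := measurable_pi_iff.2 (measurable_spacing hP)
  have hm1 : Measurable fun e : ℕ → ℝ => repeatMean N h (sumWalk (e 0) (tailSeq e)) :=
    measurable_repeatMean N hhm
      (measurable_sumWalk (measurable_pi_apply 0) fun i => measurable_pi_apply (i + 1))
  have hm2 : Measurable fun e : ℕ → ℝ =>
      ∏ i ∈ Finset.range N, h i (maxWalk (e 0) (tailSeq e) i) :=
    Finset.measurable_fun_prod _ fun j _ =>
      (hhm j).comp ((measurable_pi_apply j).comp measurable_runningMax)
  calc ∫⁻ ω, repeatMean N h (fun i => P i ω) ∂μ'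
      = ∫⁻ ω, repeatMean N h (sumWalk (spacing P 0 ω) (tailSeq fun i => spacing P i ω)) ∂μ' := by
        simp_rw [sumWalk_spacing]
    _ = ∫⁻ e, repeatMean N h (sumWalk (e 0) (tailSeq e)) ∂(iidLaw (expMeasure 1)) := by
        rw [← map_spacing hP, lintegral_map hm1 hsp]
    _ = ∫⁻ x, maxMean N h x ∂(expMeasure 1) := by
        rw [lintegral_iidLaw _ hm1]
        refine lintegral_congr_ae ?_
        filter_upwards [ae_expMeasure_pos] with x hx
        exact (maxMean_eq_repeatMean N hhm hx.le).symm
    _ = ∫⁻ e, ∏ i ∈ Finset.range N, h i (maxWalk (e 0) (tailSeq e) i)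
          ∂(iidLaw (expMeasure 1)) := by
        rw [lintegral_iidLaw _ hm2]
        rfl

lemma weightedPoints_eq_repeatSeq (hP : IsStandardPoissonPoints P μ')
    (hG : IsCondGeometric G P μ') :
    ∀ᵐ ω ∂μ', weightedPoints (fun i => G i ω) (fun i => P i ω) =
      weightedPoints (fun _ => 1) (repeatSeq (fun i => P i ω) (fun i => G i ω - 1)) := by
  filter_upwards [ae_pos_of_condGeometric hP.measurable (ae_points_nonneg hP) hG] with ω hω
  rw [← weightedPoints_repeatSeq]
  congr 1
  funext i
  exact (Nat.sub_add_cancel (hω i)).symm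

end Poisson

/-! ### Divergence of the running maximum and transfer between probability spaces -/

lemma ae_tendsto_runningMax :
    ∀ᵐ e ∂(iidLaw (expMeasure 1)), Tendsto (maxWalk (e 0) (tailSeq e)) atTop atTop := by
  have h : ∀ᵐ e ∂(iidLaw (expMeasure 1)), ∀ N : ℕ, ∃ j, (N : ℝ) < e j := by
    refine ae_all_iff.2 fun N => ?_
    rw [ae_iff]
    set c : ℝ≥0∞ := ENNReal.ofReal (1 - Real.exp (-(N : ℝ))) with hc
    have hc1 : c < 1 := by
      rw [hc, ENNReal.ofReal_lt_one]
      linarith [Real.exp_pos (-(N : ℝ))]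
    refine le_antisymm (ge_of_tendsto' (ENNReal.tendsto_pow_atTop_nhds_zero_of_lt_one hc1)
      fun n => ?_) zero_le
    have hbox := iidLaw_box (expMeasure 1) n (fun _ => Set.Iic (N : ℝ)) fun _ => measurableSet_Iic
    rw [Finset.prod_const, Finset.card_range, expMeasure_Iic (Nat.cast_nonneg N)] at hbox
    rw [hc, ← hbox]
    refine measure_mono fun e he i _ => ?_
    simp only [not_exists, not_lt, Set.mem_ofPred_eq] at he
    exact he i
  filter_upwards [h] with e he
  refine tendsto_atTop_atTop_of_monotone (monotone_maxWalk _ _) fun b => ?_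
  obtain ⟨N, hN⟩ := exists_nat_ge b
  obtain ⟨j, hj⟩ := he N
  cases j with
  | zero => exact ⟨0, hN.trans hj.le⟩
  | succ j => exact ⟨j + 1, (hN.trans hj.le).trans (le_maxWalk _ (tailSeq e) j)⟩

/-- Convergence in distribution depends only on the laws. -/
lemma TendstoInDistribution.of_map_eq {Ω Ω' Ω₀ E : Type*} [MeasurableSpace Ω] [MeasurableSpace Ω']
    [MeasurableSpace Ω₀] [TopologicalSpace E] [MeasurableSpace E] [OpensMeasurableSpace E]
    {μ : Measure Ω} {μ' : Measure Ω'} {μ₀ : Measure Ω₀} [IsProbabilityMeasure μ]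
    [IsProbabilityMeasure μ'] [IsProbabilityMeasure μ₀] {X : ℕ → Ω → E} {Z : Ω' → E}
    {X₀ : ℕ → Ω₀ → E} {Z₀ : Ω₀ → E}
    (h : TendstoInDistribution X₀ atTop Z₀ (fun _ => μ₀) μ₀)
    (hX : ∀ n, AEMeasurable (X n) μ) (hZ : AEMeasurable Z μ')
    (hXX : ∀ n, μ.map (X n) = μ₀.map (X₀ n)) (hZZ : μ'.map Z = μ₀.map Z₀) :
    TendstoInDistribution X atTop Z (fun _ => μ) μ' where
  forall_aemeasurable := hX
  aemeasurable_limit := hZ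
  tendsto := by
    have h1 := ProbabilityMeasure.tendsto_iff_forall_integral_tendsto.1 h.tendsto
    refine ProbabilityMeasure.tendsto_iff_forall_integral_tendsto.2 fun f => ?_
    simpa only [ProbabilityMeasure.coe_mk, hXX, hZZ] using h1 f

end

/-! ### Assembly of the coupling -/

theorem mainTheorem9 {Ω Ω' : Type*} [MeasurableSpace Ω] [MeasurableSpace Ω']
    (μ : Measure Ω) [IsProbabilityMeasure μ] (μ' : Measure Ω') [IsProbabilityMeasure μ']
    (α : ℝ) (hα₀ : 0 < α) (hα₁ : α < 1)
    (ξ : ℕ → ℕ → Ω → ℕ) (hξ_law : ∀ n k, IsSibuya α (ξ n k) μ)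
    (hξ_indep : iIndepFun (fun q : ℕ × ℕ => ξ q.1 q.2) μ)
    (P : ℕ → Ω' → ℝ) (hP : IsStandardPoissonPoints P μ')
    (G : ℕ → Ω' → ℕ) (hG : IsCondGeometric G P μ') :
    (∀ n, ∀ᵐ ω ∂μ,
      IsLocallyFiniteMeasure (LeaderElection.logPoints α (fun m k => ξ m k ω) n)) ∧
    (∀ᵐ ω ∂μ', IsLocallyFiniteMeasure (weightedPoints (fun i => G i ω) (fun i => P i ω))) ∧
    TendstoInDistribution
      (fun (n : ℕ) ω =>
        LocFinMeasure.ofMeasure (LeaderElection.logPoints α (fun m k => ξ m k ω) n))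
      atTop
      (fun ω => LocFinMeasure.ofMeasure (weightedPoints (fun i => G i ω) (fun i => P i ω)))
      (fun _ => μ) μ' := by
  have hpow : ∀ n : ℕ, 0 < α ^ n := fun n => pow_pos hα₀ n
  have hpos := ae_pos_of_isSibuya hξ_law
  choose ρ hρ hsib hgap using exists_map_survivorGap μ hα₀.le hξ_law hξ_indep
  have hgapm : ∀ n, Measurable fun ω =>
      LeaderElection.survivorGap (fun m k => ξ m k ω) n := fun n =>
    measurable_pi_iff.2 fun i =>
      LeaderElection.measurable_survivorGap n (fun k _ j => (hξ_law k j).1) i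
  have hQm := measurable_repeatSeq_points hP hG
  have hQlaw := map_repeatSeq_points hP hG
  have hQeq := weightedPoints_eq_repeatSeq hP hG
  have hΨ : Measurable fun x : ℕ → ℝ => weightedPoints (fun _ => 1) x :=
    measurable_weightedPoints (fun _ => measurable_const) measurable_pi_apply
  have hΦ : Measurable fun x : ℕ → ℝ =>
      LocFinMeasure.ofMeasure (weightedPoints (fun _ => 1) x) :=
    LocFinMeasure.measurable_ofMeasure.comp hΨ
  have hΦn : ∀ n, Measurable fun D : ℕ → ℕ => LocFinMeasure.ofMeasure
      (weightedPoints (fun _ => 1) (LeaderElection.logSums (α ^ n) D)) := fun n =>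
    hΦ.comp (measurable_pi_iff.2 fun j => LeaderElection.measurable_logSums _ j)
  have hquant : ∀ n, Measurable fun (e : ℕ → ℝ) i => expQuantile (ρ n) (e i) := fun n =>
    measurable_pi_iff.2 fun i => (measurable_expQuantile (ρ n)).comp (measurable_pi_apply i)
  have hXae : ∀ n, (fun ω => LocFinMeasure.ofMeasure
      (LeaderElection.logPoints α (fun m k => ξ m k ω) n)) =ᵐ[μ] fun ω =>
      LocFinMeasure.ofMeasure (weightedPoints (fun _ => 1) (LeaderElection.logSums (α ^ n)
        (LeaderElection.survivorGap (fun m k => ξ m k ω) n))) := by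
    intro n
    filter_upwards [hpos] with ω hω
    rw [LeaderElection.logPoints_eq hω]
  have hZae : (fun ω => LocFinMeasure.ofMeasure
      (weightedPoints (fun i => G i ω) (fun i => P i ω))) =ᵐ[μ'] fun ω =>
      LocFinMeasure.ofMeasure (weightedPoints (fun _ => 1)
        (repeatSeq (fun i => P i ω) (fun i => G i ω - 1))) := by
    filter_upwards [hQeq] with ω hω
    rw [hω]
  refine ⟨fun n => ?_, ?_, ?_⟩
  · filter_upwards [hpos] with ω hω
    rw [LeaderElection.logPoints_eq hω]
    exact isLocallyFiniteMeasure_weightedPoints (LeaderElection.tendsto_logSums_atTop (hpow n)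
      (LeaderElection.survivorGap_pos hω n))
  -- Local finiteness is a measurable property of the law, so it is inherited from the running
  -- maximum, which tends to infinity.
  · have h1 : ∀ᵐ x ∂(μ'.map fun ω => repeatSeq (fun i => P i ω) (fun i => G i ω - 1)),
        IsLocallyFiniteMeasure (weightedPoints (fun _ => 1) x) := by
      rw [hQlaw]
      refine (ae_map_iff measurable_runningMax.aemeasurable
        (hΨ LocFinMeasure.measurableSet_isLocallyFiniteMeasure)).2 ?_
      filter_upwards [ae_tendsto_runningMax] with e he
      exact isLocallyFiniteMeasure_weightedPoints he
    filter_upwards [ae_of_ae_map hQm.aemeasurable h1, hQeq] with ω h2 h3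
    rwa [h3]
  · have hβ0 : Tendsto (fun n : ℕ => α ^ n) atTop (nhds 0) :=
      tendsto_pow_atTop_nhds_zero_of_lt_one hα₀.le hα₁
    -- The same exponentials drive all `n` as well as the limit, so almost sure convergence is
    -- available.
    have hlim : TendstoInDistribution
        (fun (n : ℕ) (e : ℕ → ℝ) => LocFinMeasure.ofMeasure (weightedPoints (fun _ => 1)
          (LeaderElection.logSums (α ^ n) fun i => expQuantile (ρ n) (e i)))) atTop
        (fun e => LocFinMeasure.ofMeasure (weightedPoints (fun _ => 1)
          (maxWalk (e 0) (tailSeq e))))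
        (fun _ => iidLaw (expMeasure 1)) (iidLaw (expMeasure 1)) := by
      refine tendstoInDistribution_of_ae_tendsto
        (fun n => ((hΦn n).comp (hquant n)).aemeasurable)
        (hΦ.comp measurable_runningMax).aemeasurable ?_
      filter_upwards [ae_tendsto_runningMax, ae_iidLaw _ ae_expMeasure_pos] with e he hepos
      have hq : ∀ n i, 0 < expQuantile (ρ n) (e i) := fun n i =>
        (hsib n).expQuantile_pos (hepos i)
      exact tendsto_ofMeasure_weightedPoints
        (Eventually.of_forall fun n => LeaderElection.monotone_logSums (hpow n).le (hq n))
        (Eventually.of_forall fun n => LeaderElection.tendsto_logSums_atTop (hpow n) (hq n))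
        he (monotone_maxWalk _ _) fun j => tendsto_mul_log_sum hpow hβ0 hq
          (fun i => tendsto_mul_log_expQuantile hpow hβ0 hsib (hepos i)) j
    -- Back from the coupling: the quantile transforms have the law of the true gaps, and the
    -- running maximum has that of the repeated Poisson points.
    refine TendstoInDistribution.of_map_eq hlim
      (fun n => ((hΦn n).comp (hgapm n)).aemeasurable.congr (hXae n).symm)
      ((hΦ.comp hQm).aemeasurable.congr hZae.symm) (fun n => ?_) ?_
    · rw [Measure.map_congr (hXae n)]
      calc μ.map _ = (μ.map fun ω => LeaderElection.survivorGap (fun m k => ξ m k ω) n).map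
            (fun D : ℕ → ℕ => LocFinMeasure.ofMeasure
              (weightedPoints (fun _ => 1) (LeaderElection.logSums (α ^ n) D))) :=
            (Measure.map_map (hΦn n) (hgapm n)).symm
        _ = _ := by
            rw [hgap n, ← map_iidLaw (expMeasure 1) (measurable_expQuantile (ρ n))
              (map_expQuantile (ρ n)), Measure.map_map (hΦn n) (hquant n)]
            rfl
    · rw [Measure.map_congr hZae]
      calc μ'.map _ = (μ'.map fun ω => repeatSeq (fun i => P i ω) (fun i => G i ω - 1)).map
            (fun x => LocFinMeasure.ofMeasure (weightedPoints (fun _ => 1) x)) :=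
            (Measure.map_map hΦ hQm).symm
        _ = _ := by
            rw [hQlaw, Measure.map_map hΦ measurable_runningMax]
            rfl
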